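/- Let $G$ be a germ of biholomorphism of $\mathbb{C}^n$ fixing the origin $O$, i.e. a biholomorphism between open subsets of $\mathbb{C}^n$, defined at $O$ with $G(O)=O$, and let $\lambda_1,\dots,\lambda_n$ be the eigenvalues (with multiplicity) of its differential $dG_O$, which is assumed diagonalizable. Suppose that $|\lambda_j|=1$ and $\lambda_j^q\neq 1$ for all $j$ and all integers $q\ge 1$, and that $G$ is one-resonant with respect to all its eigenvalues with generator $\alpha\in\mathbb{N}^n\setminus\{0\}$: for every $j$, the multi-indices $L\in\mathbb{N}^n$ with $|L|\ge 2$ and $\lambda^L=\lambda_j$ are precisely $L=e_j+k\alpha$, $k\ge 1$. Suppose that $G$ is holomorphically normalizable: a biholomorphic change of coordinates fixing $O$ conjugates $G$, near $O$, to a convergent Poincaré–Dulac normal form $$z\mapsto \Big(\lambda_j z_j+\sum_{k\ge 1}a_{j,k}\,z^{k\alpha}z_j\Big)_{j=1,\dots,n}.$$ Suppose that some $a_{j,k}$ is non-zero, let $k_0\ge1$ be the least $k$ such that $a_{j,k}\ne0$ for some $j$, put $a_j=a_{j,k_0}$ and $\Lambda(G)=\sum_{j=1}^n\alpha_j\,a_j/\lambda_j$,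 and suppose that $G$ is non-degenerate, i.e. $\Lambda(G)\neq 0$. Suppose finally that, for some $1\le s<n$, $$\operatorname{Re}\Big(\frac{a_j}{\lambda_j}\frac1{\Lambda(G)}\Big)>0\ \ (1\le j\le s),\qquad \operatorname{Re}\Big(\frac{a_h}{\lambda_h}\frac1{\Lambda(G)}\Big)<0\ \ (s<h\le n).$$ 1. If $\alpha\notin\mathbb{N}^s\times\{0\}^{n-s}$, then $O$ is the only point $w$ of the domain of $G$ whose forward orbit under $G$ is defined (stays in the domain of $G$) and converges to $O$. 2. If $\alpha\in\mathbb{N}^s\times\{0\}^{n-s}$, let $d=\gcd(\alpha_1,\dots,\alpha_n)$. Then $G$ has an $s$-dimensional parabolic manifold at $O$ with $d$ connected components, each of them simply connected: there is a set $P$ in the domain of $G$, the biholomorphic image of an open subset of $\mathbb{C}^s$ that is the disjoint union of $d$ simply connected open sets, such that $O\in\overline P\setminus P$, $G(P)\subseteq P$, and $\lim_{\ell\to\infty}G^{\circ\ell}(z)=O$ for all $z\in P$. In particular, if $d=1$, then $P$ is the biholomorphic image of a simply connected open subset of $\mathbb{C}^s$. -/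

import Mathlib

open Set Filter Topology

/-- `G`, a homeomorphism between open subsets of `ℂⁿ`, represents an element of `Diff(ℂⁿ, O)`:
it is a biholomorphism between open sets, defined at the origin and fixing it. -/
structure IsBiholomorphicGerm {n : ℕ}
    (G : OpenPartialHomeomorph (Fin n → ℂ) (Fin n → ℂ)) : Prop where
  zero_mem_source : (0 : Fin n → ℂ) ∈ G.source
  map_zero : G 0 = 0
  differentiableOn : DifferentiableOn ℂ G G.source
  differentiableOn_symm : DifferentiableOn ℂ G.symm G.target

/-- The monomial `z^L = z₁^{L₁} ⋯ zₙ^{Lₙ}`. -/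
def monomialPow {n : ℕ} (z : Fin n → ℂ) (L : Fin n → ℕ) : ℂ :=
  ∏ i, z i ^ L i

/-- `Res_j(lam)`: the multi-indices `L` with `|L| ≥ 2` and `lam^L = lam_j`. -/
def resonances {n : ℕ} (lam : Fin n → ℂ) (j : Fin n) : Set (Fin n → ℕ) :=
  {L | 2 ≤ ∑ i, L i ∧ monomialPow lam L = lam j}

/-- The differential of `G` at the origin is diagonalizable, with eigenvalues
`lam₁, …, lamₙ` listed with multiplicity. -/
def HasDiagonalizableDifferential {n : ℕ}
    (G : OpenPartialHomeomorph (Fin n → ℂ) (Fin n → ℂ)) (lam : Fin n → ℂ) : Prop :=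
  ∃ b : Module.Basis (Fin n) ℂ (Fin n → ℂ), ∀ j, fderiv ℂ G 0 (b j) = lam j • b j

/-- `G` is one-resonant with respect to all its eigenvalues `lam₁, …, lamₙ`, with generator
`α ≠ 0`: the resonances are precisely the pairs `(j, e_j + k α)` with `k ≥ 1`. -/
structure IsOneResonant {n : ℕ} (G : OpenPartialHomeomorph (Fin n → ℂ) (Fin n → ℂ))
    (lam : Fin n → ℂ) (α : Fin n → ℕ) : Prop where
  differential : HasDiagonalizableDifferential G lam
  generator_ne_zero : α ≠ 0
  resonances_eq : ∀ j, resonances lam j = {L | ∃ k : ℕ, 1 ≤ k ∧ L = Pi.single j 1 + k • α}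

/-- `G` is conjugated, by a biholomorphic change of coordinates `Φ` fixing the origin, to the
convergent Poincaré–Dulac normal form whose `j`-th component is
`lam_j z_j + ∑_{k ≥ 1} a_{j,k} z^{kα} z_j` near the origin. (The value `a j 0` is not used.) -/
def HasHolomorphicNormalForm {n : ℕ} (G : OpenPartialHomeomorph (Fin n → ℂ) (Fin n → ℂ))
    (lam : Fin n → ℂ) (α : Fin n → ℕ) (a : Fin n → ℕ → ℂ) : Prop :=
  ∃ Φ : OpenPartialHomeomorph (Fin n → ℂ) (Fin n → ℂ), IsBiholomorphicGerm Φ ∧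
    ∀ᶠ z in 𝓝 (0 : Fin n → ℂ), ∀ j,
      HasSum (fun k : ℕ => a j (k + 1) * monomialPow z α ^ (k + 1) * z j)
        (Φ (G (Φ.symm z)) j - lam j * z j)

/-- `k₀` is the weighted order: the least `k ≥ 1` for which some coefficient `a_{j,k}` of the
normal form is non-zero. -/
def IsWeightedOrder {n : ℕ} (a : Fin n → ℕ → ℂ) (k₀ : ℕ) : Prop :=
  IsLeast {k : ℕ | 1 ≤ k ∧ ∃ j, a j k ≠ 0} k₀

/-- `Λ = ∑_j α_j a_j / lam_j`, where `a_j = a_{j,k₀}`. -/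
noncomputable def resonantLambda {n : ℕ} (lam : Fin n → ℂ) (α : Fin n → ℕ) (a : Fin n → ℕ → ℂ)
    (k₀ : ℕ) : ℂ :=
  ∑ j, (α j : ℂ) * (a j k₀ / lam j)

/-- The forward orbit of `w` under `G` is well defined (it never leaves the domain of `G`) and
converges to the origin. -/
def OrbitConvergesToOrigin {n : ℕ} (G : OpenPartialHomeomorph (Fin n → ℂ) (Fin n → ℂ))
    (w : Fin n → ℂ) : Prop :=
  (∀ l : ℕ, G^[l] w ∈ G.source) ∧ Tendsto (fun l : ℕ => G^[l] w) atTop (𝓝 0)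

/-- `P ⊆ ℂⁿ` is the biholomorphic image of the open set `D ⊆ ℂˢ`: the image of an injective
holomorphic immersion of `D` which is a homeomorphism onto its image. -/
def IsBiholomorphicImage {s n : ℕ} (D : Set (Fin s → ℂ)) (P : Set (Fin n → ℂ)) : Prop :=
  ∃ φ : (Fin s → ℂ) → (Fin n → ℂ), DifferentiableOn ℂ φ D ∧
    (∀ x ∈ D, Function.Injective (fderiv ℂ φ x)) ∧ IsEmbedding (D.domRestrict φ) ∧ φ '' D = P

/-- `P` is a parabolic manifold of dimension `s` for `G` at the origin, with `d` connected
components: `P` is the biholomorphic image of an open set in `ℂˢ` which is the disjoint union of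
`d` simply connected open sets; the origin is a boundary point of `P`; `G(P) ⊆ P`; and all orbits
in `P` converge to the origin. For `d = 1`, the open set is simply connected. -/
structure IsParabolicManifold {n : ℕ} (G : OpenPartialHomeomorph (Fin n → ℂ) (Fin n → ℂ))
    (s d : ℕ) (P : Set (Fin n → ℂ)) : Prop where
  image : ∃ D : Fin d → Set (Fin s → ℂ), (∀ i, IsOpen (D i)) ∧
    (∀ i, IsSimplyConnected (D i)) ∧ Pairwise (fun i j => Disjoint (D i) (D j)) ∧
    IsBiholomorphicImage (⋃ i, D i) P
  zero_mem_closure : (0 : Fin n → ℂ) ∈ closure P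
  zero_notMem : (0 : Fin n → ℂ) ∉ P
  subset_source : P ⊆ G.source
  mapsTo : MapsTo G P P
  orbits : ∀ z ∈ P, Tendsto (fun l : ℕ => G^[l] z) atTop (𝓝 0)

/-!
In the normalizing chart the map is `z ↦ λ_j z_j e^{L_j u}`, where `u = z^α` is the resonant
monomial and `L_j u ~ (a_j / λ_j) u ^ k₀`. Hence `u` evolves by the one-variable germ
`u ↦ u e^{S u}` with `S = ∑ α_j L_j ~ Λ u ^ k₀`, which is parabolic. Along an orbit converging to
`0` one has `u_l ^ k₀ ~ -1 / (k₀ Λ l)`, so `log |z_j|` behaves like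
`-(1 / k₀) Re (a_j / (λ_j Λ)) log l`: the `j`-th coordinate is attracted if this real part is
positive and repelled if it is negative. A repelled coordinate with `α_j ≠ 0` therefore excludes all
nonzero orbits.

If only attracted coordinates enter `z^α`, a Fatou coordinate `ψ` of the germ in `u` conjugates it
to `ψ ↦ ψ + 1` on a half strip. Solving the cohomological equations for `log z_j` over that half
strip gives coordinates in which the normal form is a translation. They determine `z` up to the
fibres of the monomial, which have `d = gcd α` components; these are permuted cyclically, because
`λ^(α / d)` is a primitive `d`-th root of unity by one-resonance.
-/

/-! ### Maps of a half plane close to the unit translation -/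

/-- The right half plane `{Re y > R}`, the shape of an attracting petal seen from infinity. -/
def rightHalfPlane (R : ℝ) : Set ℂ := {y | R < y.re}

/-- The half strip `{Re ψ > R, |Im ψ| < 1}`, over which Fatou coordinates are inverted. -/
def halfStrip (R : ℝ) : Set ℂ := {ψ | R < ψ.re ∧ |ψ.im| < 1}

theorem mem_rightHalfPlane {R : ℝ} {y : ℂ} : y ∈ rightHalfPlane R ↔ R < y.re := Iff.rfl

theorem isOpen_rightHalfPlane (R : ℝ) : IsOpen (rightHalfPlane R) :=
  isOpen_lt continuous_const Complex.continuous_re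

theorem rightHalfPlane_subset {R R' : ℝ} (h : R ≤ R') : rightHalfPlane R' ⊆ rightHalfPlane R :=
  fun _ hy => lt_of_le_of_lt h hy

theorem eventually_forall_mem_rightHalfPlane {P : ℂ → Prop}
    (h : ∀ᶠ y in comap Complex.re atTop, P y) : ∀ᶠ R in atTop, ∀ y ∈ rightHalfPlane R, P y := by
  obtain ⟨T, hT⟩ := eventually_atTop.1 (eventually_comap.1 h)
  filter_upwards [eventually_ge_atTop T] with R hR y hy
  exact hT y.re (hR.trans (mem_rightHalfPlane.1 hy).le) y rfl

theorem isOpen_halfStrip (R : ℝ) : IsOpen (halfStrip R) :=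
  (isOpen_lt continuous_const Complex.continuous_re).inter
    (isOpen_lt (continuous_abs.comp Complex.continuous_im) continuous_const)

theorem convex_halfStrip (R : ℝ) : Convex ℝ (halfStrip R) := by
  have heq : halfStrip R = {ψ | R < ψ.re} ∩ ({ψ | -1 < ψ.im} ∩ {ψ | ψ.im < 1}) :=
    Set.ext fun _ => and_congr_right' abs_lt
  rw [heq]
  exact (convex_halfSpace_re_gt R).inter
    ((convex_halfSpace_im_gt (-1)).inter (convex_halfSpace_im_lt 1))

theorem add_natCast_mem_halfStrip {R : ℝ} {ψ : ℂ} (hψ : ψ ∈ halfStrip R) (l : ℕ) :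
    ψ + l ∈ halfStrip R := by
  obtain ⟨hre, him⟩ := hψ
  refine ⟨?_, ?_⟩
  · rw [Complex.add_re, Complex.natCast_re]
    exact lt_add_of_lt_of_nonneg hre l.cast_nonneg
  · rwa [Complex.add_im, Complex.natCast_im, add_zero]

/-- `h` is holomorphic on `{Re y > R}` and `‖h y‖ ≤ C (Re y)⁻ᵖ` there. -/
structure DecaysOn (h : ℂ → ℂ) (R C p : ℝ) : Prop where
  differentiableOn : DifferentiableOn ℂ h (rightHalfPlane R)
  norm_le : ∀ y ∈ rightHalfPlane R, ‖h y‖ ≤ C * y.re ^ (-p)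

namespace DecaysOn

variable {h : ℂ → ℂ} {R C p : ℝ}

theorem mono (hh : DecaysOn h R C p) {R' : ℝ} (hR : R ≤ R') : DecaysOn h R' C p :=
  ⟨hh.differentiableOn.mono (rightHalfPlane_subset hR),
    fun y hy => hh.norm_le y (rightHalfPlane_subset hR hy)⟩

theorem const_nonneg (hh : DecaysOn h R C p) (hR : 0 ≤ R) : 0 ≤ C := by
  have hre : ((R + 1 : ℝ) : ℂ).re = R + 1 := Complex.ofReal_re _
  have hmem : ((R + 1 : ℝ) : ℂ) ∈ rightHalfPlane R := mem_rightHalfPlane.2 (by linarith)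
  have hpow : 0 < (R + 1) ^ (-p) := by positivity
  refine nonneg_of_mul_nonneg_left ?_ hpow
  simpa only [hre] using (norm_nonneg _).trans (hh.norm_le _ hmem)

theorem norm_le_of_le_re (hh : DecaysOn h R C p) (hR : 0 ≤ R) (hp : 0 ≤ p) {t : ℝ} (ht : R < t)
    {y : ℂ} (hy : t ≤ y.re) : ‖h y‖ ≤ C * t ^ (-p) :=
  (hh.norm_le y (ht.trans_le hy)).trans <| mul_le_mul_of_nonneg_left
    (Real.rpow_le_rpow_of_nonpos (hR.trans_lt ht) hy (neg_nonpos.2 hp)) (hh.const_nonneg hR)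

theorem tendsto_zero (hh : DecaysOn h R C p) (hp : 0 < p) :
    Tendsto h (comap Complex.re atTop) (𝓝 0) := by
  have hlim : Tendsto (fun t : ℝ => C * t ^ (-p)) atTop (𝓝 0) := by
    simpa only [mul_zero] using (tendsto_rpow_neg_atTop hp).const_mul C
  refine squeeze_zero_norm' ?_ (hlim.comp tendsto_comap)
  filter_upwards [preimage_mem_comap (Ioi_mem_atTop R)] with y hy
  exact hh.norm_le y hy

/-- Cauchy's estimate on a disc of radius `Re w / 2`. -/
theorem deriv (hh : DecaysOn h R C p) (hR : 0 ≤ R) (hp : 0 ≤ p) :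
    DecaysOn (deriv h) (2 * R) (C * 2 ^ (p + 1)) (p + 1) := by
  refine ⟨(hh.differentiableOn.deriv (isOpen_rightHalfPlane R)).mono
    (rightHalfPlane_subset (by linarith)), fun w hw => ?_⟩
  rw [mem_rightHalfPlane] at hw
  have hre : ∀ z ∈ Metric.closedBall w (w.re / 2), w.re / 2 ≤ z.re := fun z hz => by
    rw [Metric.mem_closedBall, dist_eq_norm] at hz
    have := (abs_le.1 ((Complex.abs_re_le_norm (z - w)).trans hz)).1
    rw [Complex.sub_re] at this
    linarith
  have hsub : Metric.closedBall w (w.re / 2) ⊆ rightHalfPlane R := fun z hz =>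
    mem_rightHalfPlane.2 (by linarith [hre z hz])
  have hdiff : DiffContOnCl ℂ h (Metric.ball w (w.re / 2)) :=
    (hh.differentiableOn.mono (Metric.closure_ball_subset_closedBall.trans hsub)).diffContOnCl
  have hsphere : ∀ z ∈ Metric.sphere w (w.re / 2), ‖h z‖ ≤ C * (w.re / 2) ^ (-p) := fun z hz =>
    hh.norm_le_of_le_re hR hp (by linarith) (hre z (Metric.sphere_subset_closedBall hz))
  have hw0 : 0 < w.re := by linarith
  calc ‖_root_.deriv h w‖ ≤ C * (w.re / 2) ^ (-p) / (w.re / 2) :=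
        Complex.norm_deriv_le_of_forall_mem_sphere_norm_le (by linarith) hdiff hsphere
    _ = C * (w.re / 2) ^ (-(p + 1)) := by
        rw [neg_add', Real.rpow_sub_one (by positivity), mul_div_assoc]
    _ = C * 2 ^ (p + 1) * w.re ^ (-(p + 1)) := by
        rw [Real.div_rpow hw0.le zero_le_two, Real.rpow_neg zero_le_two, div_inv_eq_mul]
        ring

theorem norm_sub_le (hh : DecaysOn h R C p) (hR : 0 ≤ R) (hp : 0 ≤ p) {t : ℝ} (ht : 2 * R < t)
    {w w' : ℂ} (hw : t ≤ w.re) (hw' : t ≤ w'.re) :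
    ‖h w - h w'‖ ≤ C * 2 ^ (p + 1) * t ^ (-(p + 1)) * ‖w - w'‖ := by
  refine (convex_halfSpace_re_ge t).norm_image_sub_le_of_norm_deriv_le (𝕜 := ℂ) (fun z hz => ?_)
    (fun z hz => (hh.deriv hR hp).norm_le_of_le_re (by positivity) (by positivity) ht hz) hw' hw
  have hz : t ≤ z.re := hz
  exact hh.differentiableOn.differentiableAt
    ((isOpen_rightHalfPlane R).mem_nhds (mem_rightHalfPlane.2 (by linarith)))

end DecaysOn

/-- `f` maps the half plane `{Re y > R}` holomorphically to itself and moves points to the right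
by at least `1/2`. -/
structure MovesRight (f : ℂ → ℂ) (R : ℝ) : Prop where
  differentiableOn : DifferentiableOn ℂ f (rightHalfPlane R)
  add_half_le : ∀ y ∈ rightHalfPlane R, y.re + 1 / 2 ≤ (f y).re

namespace MovesRight

variable {f : ℂ → ℂ} {R : ℝ}

theorem mapsTo (hf : MovesRight f R) : MapsTo f (rightHalfPlane R) (rightHalfPlane R) := by
  intro y hy
  have := hf.add_half_le y hy
  rw [mem_rightHalfPlane] at hy ⊢
  linarith

theorem iterate_mem (hf : MovesRight f R) {y : ℂ} (hy : y ∈ rightHalfPlane R) (l : ℕ) :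
    f^[l] y ∈ rightHalfPlane R := hf.mapsTo.iterate l hy

theorem le_re_iterate (hf : MovesRight f R) {y : ℂ} (hy : y ∈ rightHalfPlane R) (l : ℕ) :
    y.re + l / 2 ≤ (f^[l] y).re := by
  induction l with
  | zero => simp
  | succ l ih =>
    rw [Function.iterate_succ_apply']
    have := hf.add_half_le _ (hf.iterate_mem hy l)
    push_cast
    linarith

theorem tendsto_re_iterate (hf : MovesRight f R) {y : ℂ} (hy : y ∈ rightHalfPlane R) :
    Tendsto (fun l : ℕ => (f^[l] y).re) atTop atTop :=
  tendsto_atTop_mono (hf.le_re_iterate hy) <| tendsto_atTop_add_const_left _ _ <|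
    tendsto_natCast_atTop_atTop.atTop_div_const two_pos

theorem differentiableOn_iterate (hf : MovesRight f R) (l : ℕ) :
    DifferentiableOn ℂ (f^[l]) (rightHalfPlane R) := by
  induction l with
  | zero => exact differentiableOn_id
  | succ l ih =>
    rw [Function.iterate_succ']
    exact hf.differentiableOn.comp ih (hf.mapsTo.iterate l)

end MovesRight

theorem summable_add_half_rpow_neg {p R : ℝ} (hp : 1 < p) (hR : 0 < R) :
    Summable (fun l : ℕ => (R + (l : ℝ) / 2) ^ (-p)) := by
  refine (((Real.summable_one_div_nat_add_rpow (2 * R) p).2 hp).mul_left ((1 / 2) ^ (-p))).congr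
    fun l => ?_
  have hl : 0 ≤ (l : ℝ) + 2 * R := by positivity
  rw [abs_of_nonneg hl, one_div (_ ^ p), ← Real.rpow_neg hl, ← Real.mul_rpow (by norm_num) hl]
  ring_nf

theorem tendsto_tsum_add_half_rpow_neg {p : ℝ} (hp : 1 < p) :
    Tendsto (fun R : ℝ => ∑' l : ℕ, (R + (l : ℝ) / 2) ^ (-p)) atTop (𝓝 0) := by
  have hterm (l : ℕ) : Tendsto (fun R : ℝ => (R + (l : ℝ) / 2) ^ (-p)) atTop (𝓝 0) :=
    (tendsto_rpow_neg_atTop (by linarith)).comp (tendsto_atTop_add_const_right _ _ tendsto_id)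
  have hdom : ∀ᶠ R : ℝ in atTop, ∀ l : ℕ,
      ‖(R + (l : ℝ) / 2) ^ (-p)‖ ≤ (1 + (l : ℝ) / 2) ^ (-p) := by
    filter_upwards [eventually_ge_atTop 1] with R hR l
    rw [Real.norm_of_nonneg (by positivity)]
    exact Real.rpow_le_rpow_of_nonpos (by positivity) (by linarith) (by linarith)
  simpa only [tsum_zero] using
    tendsto_tsum_of_dominated_convergence (summable_add_half_rpow_neg hp one_pos) hterm hdom

/-- The solution `m = -∑ₗ h ∘ fˡ` of the cohomological equation `m ∘ f - m = h`. -/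
noncomputable def cohomologicalSolution (f h : ℂ → ℂ) (y : ℂ) : ℂ := -∑' l : ℕ, h (f^[l] y)

section CohomologicalEquation

variable {f h : ℂ → ℂ} {R C p : ℝ} (hf : MovesRight f R) (hh : DecaysOn h R C p) (hR : 0 < R)
  (hp : 1 < p)

include hf hh hR hp

theorem norm_comp_iterate_le {y : ℂ} (hy : y ∈ rightHalfPlane R) (l : ℕ) :
    ‖h (f^[l] y)‖ ≤ C * (R + (l : ℝ) / 2) ^ (-p) := by
  have hC := hh.const_nonneg hR.le
  have hre := hf.le_re_iterate hy l
  rw [mem_rightHalfPlane] at hy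
  refine (hh.norm_le _ (hf.iterate_mem hy l)).trans (mul_le_mul_of_nonneg_left ?_ hC)
  exact Real.rpow_le_rpow_of_nonpos (by positivity) (by linarith) (by linarith)

theorem summable_comp_iterate {y : ℂ} (hy : y ∈ rightHalfPlane R) :
    Summable (fun l : ℕ => h (f^[l] y)) :=
  .of_norm_bounded ((summable_add_half_rpow_neg hp hR).mul_left C)
    (norm_comp_iterate_le hf hh hR hp hy)

theorem cohomologicalSolution_comp {y : ℂ} (hy : y ∈ rightHalfPlane R) :
    cohomologicalSolution f h (f y) = cohomologicalSolution f h y + h y := by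
  have := (summable_comp_iterate hf hh hR hp hy).tsum_eq_zero_add
  simp only [cohomologicalSolution, this, Function.iterate_succ_apply, Function.iterate_zero, id_eq]
  ring

theorem norm_cohomologicalSolution_le {y : ℂ} (hy : y ∈ rightHalfPlane R) :
    ‖cohomologicalSolution f h y‖ ≤ ∑' l : ℕ, C * (R + (l : ℝ) / 2) ^ (-p) := by
  rw [cohomologicalSolution, norm_neg]
  exact tsum_of_norm_bounded ((summable_add_half_rpow_neg hp hR).mul_left C).hasSum
    (norm_comp_iterate_le hf hh hR hp hy)

theorem differentiableOn_cohomologicalSolution :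
    DifferentiableOn ℂ (cohomologicalSolution f h) (rightHalfPlane R) :=
  (Complex.differentiableOn_tsum_of_summable_norm
    ((summable_add_half_rpow_neg hp hR).mul_left C)
    (fun l => hh.differentiableOn.comp (hf.differentiableOn_iterate l) (hf.mapsTo.iterate l))
    (isOpen_rightHalfPlane R) (fun l _ hy => norm_comp_iterate_le hf hh hR hp hy l)).neg

end CohomologicalEquation

/-- The deviation of `f` from the unit translation. -/
def translationError (f : ℂ → ℂ) (y : ℂ) : ℂ := f y - y - 1

/-- The translation errors along two `f`-orbits in `{Re y > R}` differ, in total, by at most half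
the distance between the two starting points, with summable rates `κ`. -/
structure HasSmallDistortion (f : ℂ → ℂ) (R : ℝ) (κ : ℕ → ℝ) : Prop where
  movesRight : MovesRight f R
  tendsto_error : ∀ y ∈ rightHalfPlane R,
    Tendsto (fun l : ℕ => translationError f (f^[l] y)) atTop (𝓝 0)
  rate_nonneg : ∀ l, 0 ≤ κ l
  summable_rate : Summable κ
  tsum_rate_le : ∑' l, κ l ≤ 1 / 2
  norm_error_sub_le : ∀ y ∈ rightHalfPlane R, ∀ y' ∈ rightHalfPlane R, ∀ l : ℕ,
    ‖translationError f (f^[l] y) - translationError f (f^[l] y')‖ ≤ κ l * ‖y - y'‖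

theorem eventually_movesRight {f : ℂ → ℂ} {R C δ : ℝ} (hf : DecaysOn (translationError f) R C δ)
    (hδ : 0 < δ) : ∀ᶠ R' in atTop, MovesRight f R' := by
  have hsmall : ∀ᶠ y in comap Complex.re atTop, ‖translationError f y‖ < 1 / 2 := by
    simpa only [dist_zero_right] using Metric.tendsto_nhds.1 (hf.tendsto_zero hδ) _ one_half_pos
  filter_upwards [eventually_ge_atTop R, eventually_forall_mem_rightHalfPlane hsmall]
    with R' hR hR'
  refine ⟨?_, fun y hy => ?_⟩
  · have hd := ((hf.mono hR).differentiableOn.add differentiableOn_id).add_const 1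
    refine hd.congr fun y _ => ?_
    simp only [translationError, Pi.add_apply, id_eq]
    ring
  · have := abs_lt.1 ((Complex.abs_re_le_norm _).trans_lt (hR' y hy))
    simp only [translationError, Complex.sub_re, Complex.one_re] at this
    linarith

/-- If the errors contract along orbits at rates `κ`, then by Grönwall's inequality the iterates
are uniformly `2`-Lipschitz. -/
theorem norm_iterate_sub_le {f : ℂ → ℂ} {κ : ℕ → ℝ} (hκ : ∀ l, 0 ≤ κ l) (hκs : Summable κ)
    (hκsum : ∑' l, κ l ≤ 1 / 4) {y y' : ℂ}
    (herr : ∀ l : ℕ, ‖translationError f (f^[l] y) - translationError f (f^[l] y')‖ ≤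
      κ l * ‖f^[l] y - f^[l] y'‖) (l : ℕ) : ‖f^[l] y - f^[l] y'‖ ≤ 2 * ‖y - y'‖ := by
  have hstep (l : ℕ) :
      ‖f^[l + 1] y - f^[l + 1] y'‖ ≤ (1 + κ l) * ‖f^[l] y - f^[l] y'‖ + 0 := by
    have hsplit : f^[l + 1] y - f^[l + 1] y' = (f^[l] y - f^[l] y')
        + (translationError f (f^[l] y) - translationError f (f^[l] y')) := by
      simp only [translationError, Function.iterate_succ_apply']
      ring
    rw [hsplit, add_zero, add_mul, one_mul]
    exact (norm_add_le _ _).trans (by gcongr; exact herr l)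
  have hgronwall := discrete_gronwall (u := fun l => ‖f^[l] y - f^[l] y'‖) (n₀ := 0) (b := 0)
    (norm_nonneg _) (fun l _ => hstep l) (fun l _ => hκ l) (fun _ _ => le_rfl) l.zero_le
  have hexp : Real.exp (∑ i ∈ Finset.Ico 0 l, κ i) ≤ 2 := by
    rw [← Real.le_log_iff_exp_le two_pos]
    have := (hκs.sum_le_tsum (Finset.Ico 0 l) fun i _ => hκ i).trans hκsum
    linarith [Real.log_two_gt_d9]
  calc ‖f^[l] y - f^[l] y'‖ ≤ ‖y - y'‖ * Real.exp (∑ i ∈ Finset.Ico 0 l, κ i) := by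
        simpa using hgronwall
    _ ≤ ‖y - y'‖ * 2 := by gcongr
    _ = 2 * ‖y - y'‖ := mul_comm _ _

theorem eventually_hasSmallDistortion {f : ℂ → ℂ} {R C δ : ℝ}
    (hf : DecaysOn (translationError f) R C δ) (hR : 0 ≤ R) (hδ : 0 < δ) :
    ∀ᶠ R' in atTop, ∃ κ, HasSmallDistortion f R' κ := by
  have hC := hf.const_nonneg hR
  set K : ℝ := C * 2 ^ (δ + 1)
  have hp : 1 < δ + 1 := by linarith
  have hlim : Tendsto (fun R' : ℝ => K * ∑' l : ℕ, (R' + (l : ℝ) / 2) ^ (-(δ + 1))) atTop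
      (𝓝 0) := by
    simpa only [mul_zero] using (tendsto_tsum_add_half_rpow_neg hp).const_mul K
  filter_upwards [hlim.eventually_le_const (show (0 : ℝ) < 1 / 4 by norm_num),
    eventually_movesRight hf hδ, eventually_gt_atTop (2 * R), eventually_gt_atTop 0]
    with R' hsum hmoves hR' hR'0
  set κ : ℕ → ℝ := fun l => K * (R' + (l : ℝ) / 2) ^ (-(δ + 1))
  have hκ (l : ℕ) : 0 ≤ κ l := by positivity
  have hκs : Summable κ := (summable_add_half_rpow_neg hp hR'0).mul_left K
  have hκsum : ∑' l, κ l ≤ 1 / 4 := by rwa [tsum_mul_left]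
  have herr : ∀ y ∈ rightHalfPlane R', ∀ y' ∈ rightHalfPlane R', ∀ l : ℕ,
      ‖translationError f (f^[l] y) - translationError f (f^[l] y')‖
        ≤ κ l * ‖f^[l] y - f^[l] y'‖ := by
    intro y hy y' hy' l
    have hre := hmoves.le_re_iterate hy l
    have hre' := hmoves.le_re_iterate hy' l
    have hl : (0 : ℝ) ≤ l := l.cast_nonneg
    rw [mem_rightHalfPlane] at hy hy'
    exact hf.norm_sub_le hR hδ.le (by linarith) (by linarith) (by linarith)
  refine ⟨fun l => 2 * κ l, hmoves, fun y hy => ?_, fun l => by positivity, hκs.mul_left 2, ?_, ?_⟩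
  · exact (hf.tendsto_zero hδ).comp (tendsto_comap_iff.2 (hmoves.tendsto_re_iterate hy))
  · rw [tsum_mul_left]
    linarith
  · intro y hy y' hy' l
    calc _ ≤ κ l * ‖f^[l] y - f^[l] y'‖ := herr y hy y' hy' l
      _ ≤ κ l * (2 * ‖y - y'‖) := mul_le_mul_of_nonneg_left
          (norm_iterate_sub_le hκ hκs hκsum (herr y hy y' hy') l) (hκ l)
      _ = 2 * κ l * ‖y - y'‖ := by ring

/-- `Ψ` is a Fatou coordinate of `f` on `{Re y > R}`: it is holomorphic, conjugates `f` to the unit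
translation, and is so close to the identity that `Ψ - id` is `1/2`-Lipschitz. -/
structure IsFatouCoordinate (f Ψ : ℂ → ℂ) (R : ℝ) : Prop where
  movesRight : MovesRight f R
  differentiableOn : DifferentiableOn ℂ Ψ (rightHalfPlane R)
  map_apply : ∀ y ∈ rightHalfPlane R, Ψ (f y) = Ψ y + 1
  norm_sub_sub_le : ∀ y ∈ rightHalfPlane R, ∀ y' ∈ rightHalfPlane R,
    ‖Ψ y - Ψ y' - (y - y')‖ ≤ 1 / 2 * ‖y - y'‖

/-- The Fatou coordinate of `f`, the limit of `f^[l] y - f^[l] b + b`, normalized by the base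
point `b`. -/
noncomputable def fatouCoordinate (f : ℂ → ℂ) (b y : ℂ) : ℂ :=
  y + ∑' l : ℕ, (translationError f (f^[l] y) - translationError f (f^[l] b))

namespace HasSmallDistortion

variable {f : ℂ → ℂ} {R : ℝ} {κ : ℕ → ℝ}

theorem summable_error_sub (hf : HasSmallDistortion f R κ) {y y' : ℂ} (hy : y ∈ rightHalfPlane R)
    (hy' : y' ∈ rightHalfPlane R) :
    Summable (fun l : ℕ => translationError f (f^[l] y) - translationError f (f^[l] y')) :=
  .of_norm_bounded (hf.summable_rate.mul_right _) (hf.norm_error_sub_le y hy y' hy')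

theorem fatouCoordinate_sub (hf : HasSmallDistortion f R κ) {b y y' : ℂ}
    (hb : b ∈ rightHalfPlane R) (hy : y ∈ rightHalfPlane R) (hy' : y' ∈ rightHalfPlane R) :
    fatouCoordinate f b y - fatouCoordinate f b y' = (y - y') +
      ∑' l : ℕ, (translationError f (f^[l] y) - translationError f (f^[l] y')) := by
  have hsub := (hf.summable_error_sub hy hb).tsum_sub (hf.summable_error_sub hy' hb)
  simp only [sub_sub_sub_cancel_right] at hsub
  rw [hsub, fatouCoordinate, fatouCoordinate]
  ring

theorem tsum_error_sub_comp (hf : HasSmallDistortion f R κ) {y : ℂ} (hy : y ∈ rightHalfPlane R) :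
    ∑' l : ℕ, (translationError f (f^[l] (f y)) - translationError f (f^[l] y))
      = -translationError f y := by
  refine tendsto_nhds_unique
    (hf.summable_error_sub (hf.movesRight.mapsTo hy) hy).hasSum.tendsto_sum_nat ?_
  have htelescope (N : ℕ) := Finset.sum_range_sub (fun l => translationError f (f^[l] y)) N
  simp only [Function.iterate_succ_apply, Function.iterate_zero, id_eq] at htelescope
  simpa only [htelescope, zero_sub] using
    (hf.tendsto_error y hy).sub_const (translationError f y)

theorem differentiableOn_fatouCoordinate (hf : HasSmallDistortion f R κ) {b : ℂ}
    (hb : b ∈ rightHalfPlane R) (hd : DifferentiableOn ℂ (translationError f) (rightHalfPlane R)) :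
    DifferentiableOn ℂ (fatouCoordinate f b) (rightHalfPlane R) := by
  refine differentiableOn_id.add fun y hy => ?_
  have hopen : IsOpen (rightHalfPlane R ∩ Metric.ball b (‖y - b‖ + 1)) :=
    (isOpen_rightHalfPlane R).inter Metric.isOpen_ball
  have hyU : y ∈ rightHalfPlane R ∩ Metric.ball b (‖y - b‖ + 1) :=
    ⟨hy, mem_ball_iff_norm.2 (lt_add_one _)⟩
  have hsum := Complex.differentiableOn_tsum_of_summable_norm
    (hf.summable_rate.mul_right (‖y - b‖ + 1))
    (F := fun (l : ℕ) y => translationError f (f^[l] y) - translationError f (f^[l] b))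
    (fun l => ?_) hopen (fun l w hw => ?_)
  · exact (hsum.differentiableAt (hopen.mem_nhds hyU)).differentiableWithinAt
  · exact ((hd.comp (hf.movesRight.differentiableOn_iterate l)
      (hf.movesRight.mapsTo.iterate l)).mono inter_subset_left).sub_const _
  · exact (hf.norm_error_sub_le w hw.1 b hb l).trans
      (mul_le_mul_of_nonneg_left (mem_ball_iff_norm.1 hw.2).le (hf.rate_nonneg l))

theorem isFatouCoordinate (hf : HasSmallDistortion f R κ) {b : ℂ} (hb : b ∈ rightHalfPlane R)
    (hd : DifferentiableOn ℂ (translationError f) (rightHalfPlane R)) :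
    IsFatouCoordinate f (fatouCoordinate f b) R where
  movesRight := hf.movesRight
  differentiableOn := hf.differentiableOn_fatouCoordinate hb hd
  map_apply y hy := by
    rw [← sub_eq_iff_eq_add', hf.fatouCoordinate_sub hb (hf.movesRight.mapsTo hy) hy,
      hf.tsum_error_sub_comp hy, translationError]
    ring
  norm_sub_sub_le y hy y' hy' := by
    rw [hf.fatouCoordinate_sub hb hy hy', add_sub_cancel_left]
    refine (tsum_of_norm_bounded (hf.summable_rate.mul_right _).hasSum
      (hf.norm_error_sub_le y hy y' hy')).trans ?_
    rw [tsum_mul_right]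
    exact mul_le_mul_of_nonneg_right hf.tsum_rate_le (norm_nonneg _)

end HasSmallDistortion

namespace IsFatouCoordinate

variable {f Ψ : ℂ → ℂ} {R : ℝ}

theorem approximatesLinearOn (hΨ : IsFatouCoordinate f Ψ R) :
    ApproximatesLinearOn Ψ (ContinuousLinearEquiv.refl ℂ ℂ : ℂ →L[ℂ] ℂ) (rightHalfPlane R)
      (1 / 2) := by
  intro y hy y' hy'
  simpa using hΨ.norm_sub_sub_le y hy y' hy'

theorem half_lt_inv_nnnorm_refl_symm :
    (1 / 2 : NNReal) < ‖((ContinuousLinearEquiv.refl ℂ ℂ).symm : ℂ →L[ℂ] ℂ)‖₊⁻¹ := by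
  simpa using NNReal.half_lt_self one_ne_zero

/-- A Fatou coordinate as a homeomorphism from the half plane onto an open subset of `ℂ`. -/
noncomputable def toOpenPartialHomeomorph (hΨ : IsFatouCoordinate f Ψ R) :
    OpenPartialHomeomorph ℂ ℂ :=
  hΨ.approximatesLinearOn.toOpenPartialHomeomorph Ψ _ (.inr half_lt_inv_nnnorm_refl_symm)
    (isOpen_rightHalfPlane R)

theorem closedBall_subset_target (hΨ : IsFatouCoordinate f Ψ R) {y : ℂ} {r : ℝ} (hr : 0 ≤ r)
    (hy : Metric.closedBall y r ⊆ rightHalfPlane R) :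
    Metric.closedBall (Ψ y) (r / 2) ⊆ hΨ.toOpenPartialHomeomorph.target := by
  have hsub := hΨ.approximatesLinearOn.closedBall_subset_target
    (.inr half_lt_inv_nnnorm_refl_symm) (isOpen_rightHalfPlane R) hr hy
  refine (Metric.closedBall_subset_closedBall (le_of_eq ?_)).trans hsub
  norm_num
  ring

theorem map_iterate (hΨ : IsFatouCoordinate f Ψ R) {y : ℂ} (hy : y ∈ rightHalfPlane R) (N : ℕ) :
    Ψ (f^[N] y) = Ψ y + N := by
  induction N with
  | zero => simp
  | succ N ih =>
    rw [Function.iterate_succ_apply', hΨ.map_apply _ (hΨ.movesRight.iterate_mem hy N), ih]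
    push_cast
    ring

/-- The disc of radius `N / 2` about `f^[N] b` lies in the half plane, so its image covers a disc
of radius `N / 4` about `Ψ b + N`. -/
theorem add_mem_target (hΨ : IsFatouCoordinate f Ψ R) {b ψ : ℂ} (hb : b ∈ rightHalfPlane R)
    (hψ : ψ ∈ halfStrip 8) : ψ + Ψ b ∈ hΨ.toOpenPartialHomeomorph.target := by
  obtain ⟨hre, him⟩ := hψ
  set N : ℕ := ⌊ψ.re⌋₊
  have hN : (8 : ℝ) ≤ N := by exact_mod_cast Nat.le_floor (n := 8) (by exact_mod_cast hre.le)
  have hball : Metric.closedBall (f^[N] b) (N / 2) ⊆ rightHalfPlane R := by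
    intro z hz
    rw [Metric.mem_closedBall, dist_eq_norm] at hz
    have hdist := (abs_le.1 ((Complex.abs_re_le_norm _).trans hz)).1
    have hiter := hΨ.movesRight.le_re_iterate hb N
    rw [Complex.sub_re] at hdist
    rw [mem_rightHalfPlane] at hb ⊢
    linarith
  refine hΨ.closedBall_subset_target (by positivity) hball ?_
  rw [hΨ.map_iterate hb, mem_closedBall_iff_norm, add_comm ψ, add_sub_add_left_eq_sub]
  have hdre : |(ψ - N).re| ≤ 1 := by
    rw [Complex.sub_re, Complex.natCast_re, abs_le]
    constructor <;> linarith [Nat.floor_le (by linarith : 0 ≤ ψ.re), Nat.lt_floor_add_one ψ.re]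
  have hdim : |(ψ - N).im| ≤ 1 := by
    rw [Complex.sub_im, Complex.natCast_im, sub_zero]
    exact him.le
  linarith [Complex.norm_le_abs_re_add_abs_im (ψ - N)]

theorem differentiableAt (hΨ : IsFatouCoordinate f Ψ R) {y : ℂ} (hy : y ∈ rightHalfPlane R) :
    DifferentiableAt ℂ Ψ y :=
  hΨ.differentiableOn.differentiableAt ((isOpen_rightHalfPlane R).mem_nhds hy)

theorem deriv_ne_zero (hΨ : IsFatouCoordinate f Ψ R) {y : ℂ} (hy : y ∈ rightHalfPlane R) :
    deriv Ψ y ≠ 0 := by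
  intro h0
  have hderiv := (hΨ.differentiableAt hy).hasDerivAt.sub (hasDerivAt_id y)
  have hle : ‖deriv Ψ y - 1‖ ≤ 1 / 2 := by
    refine hderiv.le_of_lip' one_half_pos.le ?_
    filter_upwards [(isOpen_rightHalfPlane R).mem_nhds hy] with z hz
    have hcomm : Ψ z - z - (Ψ y - y) = Ψ z - Ψ y - (z - y) := by ring
    simpa only [Pi.sub_apply, id_eq, hcomm] using hΨ.norm_sub_sub_le z hz y hy
  norm_num [h0] at hle

end IsFatouCoordinate

/-- `χ`, the inverse of a Fatou coordinate, is an injective immersion of the half strip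
`{Re ψ > R', |Im ψ| < 1}` in `{Re y > R}` which conjugates the unit translation to `f`. -/
structure IsFatouParametrization (f χ : ℂ → ℂ) (R R' : ℝ) : Prop where
  movesRight : MovesRight f R
  differentiableOn : DifferentiableOn ℂ χ (halfStrip R')
  mapsTo : MapsTo χ (halfStrip R') (rightHalfPlane R)
  injOn : InjOn χ (halfStrip R')
  deriv_ne_zero : ∀ ψ ∈ halfStrip R', deriv χ ψ ≠ 0
  map_add_one : ∀ ψ ∈ halfStrip R', χ (ψ + 1) = f (χ ψ)

theorem IsFatouCoordinate.isFatouParametrization {f Ψ : ℂ → ℂ} {R : ℝ} {b : ℂ}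
    (hΨ : IsFatouCoordinate f Ψ R) (hb : b ∈ rightHalfPlane R) :
    IsFatouParametrization f (fun ψ => hΨ.toOpenPartialHomeomorph.symm (ψ + Ψ b)) R 8 := by
  set e := hΨ.toOpenPartialHomeomorph
  have htarget : ∀ ψ ∈ halfStrip 8, ψ + Ψ b ∈ e.target := fun ψ hψ => hΨ.add_mem_target hb hψ
  have hmaps : ∀ ψ ∈ halfStrip 8, e.symm (ψ + Ψ b) ∈ rightHalfPlane R := fun ψ hψ =>
    e.map_target (htarget ψ hψ)
  have hright : ∀ ψ ∈ halfStrip 8, Ψ (e.symm (ψ + Ψ b)) = ψ + Ψ b := fun ψ hψ =>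
    e.right_inv (htarget ψ hψ)
  have hderiv : ∀ ψ ∈ halfStrip 8, HasDerivAt (fun ψ => e.symm (ψ + Ψ b))
      (deriv Ψ (e.symm (ψ + Ψ b)))⁻¹ ψ := fun ψ hψ =>
    .comp_add_const _ _ (e.hasDerivAt_symm (htarget ψ hψ) (hΨ.deriv_ne_zero (hmaps ψ hψ))
      (hΨ.differentiableAt (hmaps ψ hψ)).hasDerivAt)
  refine ⟨hΨ.movesRight, fun ψ hψ => (hderiv ψ hψ).differentiableAt.differentiableWithinAt, hmaps,
    fun ψ hψ ψ' hψ' h => ?_, fun ψ hψ => ?_, fun ψ hψ => ?_⟩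
  · exact add_right_cancel (e.symm.injOn (htarget ψ hψ) (htarget ψ' hψ') h)
  · rw [(hderiv ψ hψ).deriv]
    exact inv_ne_zero (hΨ.deriv_ne_zero (hmaps ψ hψ))
  · have hψ1 : ψ + 1 ∈ halfStrip 8 := by exact_mod_cast add_natCast_mem_halfStrip hψ 1
    refine e.injOn (hmaps _ hψ1) (hΨ.movesRight.mapsTo (hmaps ψ hψ)) ?_
    calc Ψ (e.symm (ψ + 1 + Ψ b)) = ψ + Ψ b + 1 := by rw [hright _ hψ1, add_right_comm]
      _ = Ψ (f (e.symm (ψ + Ψ b))) := by rw [hΨ.map_apply _ (hmaps ψ hψ), hright ψ hψ]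

theorem eventually_exists_isFatouParametrization {f : ℂ → ℂ} {R C δ : ℝ}
    (hf : DecaysOn (translationError f) R C δ) (hR : 0 ≤ R) (hδ : 0 < δ) :
    ∀ᶠ R' in atTop, ∃ (χ : ℂ → ℂ) (R'' : ℝ), IsFatouParametrization f χ R' R'' := by
  filter_upwards [eventually_hasSmallDistortion hf hR hδ, eventually_ge_atTop R]
    with R' ⟨κ, hκ⟩ hRR'
  have hb : ((R' + 1 : ℝ) : ℂ) ∈ rightHalfPlane R' :=
    mem_rightHalfPlane.2 ((lt_add_one R').trans_eq (Complex.ofReal_re _).symm)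
  exact ⟨_, _, (hκ.isFatouCoordinate hb (hf.mono hRR').differentiableOn).isFatouParametrization hb⟩

namespace IsFatouParametrization

variable {f χ : ℂ → ℂ} {R R' : ℝ} {ψ : ℂ}

theorem map_add_natCast (hχ : IsFatouParametrization f χ R R') (hψ : ψ ∈ halfStrip R') (l : ℕ) :
    χ (ψ + l) = f^[l] (χ ψ) := by
  induction l with
  | zero => simp
  | succ l ih =>
    rw [Nat.cast_succ, ← add_assoc, hχ.map_add_one _ (add_natCast_mem_halfStrip hψ l), ih,
      Function.iterate_succ_apply']

theorem tendsto_re (hχ : IsFatouParametrization f χ R R') (hψ : ψ ∈ halfStrip R') :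
    Tendsto (fun l : ℕ => (χ (ψ + l)).re) atTop atTop := by
  simpa only [hχ.map_add_natCast hψ] using hχ.movesRight.tendsto_re_iterate (hχ.mapsTo hψ)

end IsFatouParametrization

/-! ### The coordinate `y` of a petal, where `u = τ y^(-1/k)` -/

/-- `L` is holomorphic near `0` and `L u = A u^k + O(u^(k+1))`. -/
structure HasLeadingTerm (L : ℂ → ℂ) (A : ℂ) (k : ℕ) : Prop where
  analyticAt : AnalyticAt ℂ L 0
  isBigO : (fun u => L u - A * u ^ k) =O[𝓝 0] fun u => u ^ (k + 1)

namespace HasLeadingTerm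

variable {L : ℂ → ℂ} {A : ℂ} {k : ℕ}

theorem const_mul (hL : HasLeadingTerm L A k) (c : ℂ) :
    HasLeadingTerm (fun u => c * L u) (c * A) k :=
  ⟨analyticAt_const.mul hL.analyticAt, by
    simpa only [mul_assoc, ← mul_sub] using hL.isBigO.const_mul_left c⟩

theorem sub {L' : ℂ → ℂ} {A' : ℂ} (hL : HasLeadingTerm L A k) (hL' : HasLeadingTerm L' A' k) :
    HasLeadingTerm (fun u => L u - L' u) (A - A') k :=
  ⟨hL.analyticAt.sub hL'.analyticAt, by
    simpa only [sub_mul, sub_sub_sub_comm] using hL.isBigO.sub hL'.isBigO⟩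

theorem sum {ι : Type*} {s : Finset ι} {L : ι → ℂ → ℂ} {A : ι → ℂ}
    (hL : ∀ j ∈ s, HasLeadingTerm (L j) (A j) k) :
    HasLeadingTerm (fun u => ∑ j ∈ s, L j u) (∑ j ∈ s, A j) k :=
  ⟨Finset.analyticAt_fun_sum s fun j hj => (hL j hj).analyticAt, by
    simpa only [Finset.sum_mul, ← Finset.sum_sub_distrib] using
      Asymptotics.IsBigO.fun_sum fun j hj => (hL j hj).isBigO⟩

theorem isLittleO (hL : HasLeadingTerm L A k) :
    (fun u => L u - A * u ^ k) =o[𝓝 0] fun u => u ^ k :=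
  hL.isBigO.trans_isLittleO (Asymptotics.isLittleO_pow_pow k.lt_succ_self)

theorem isBigO_pow (hL : HasLeadingTerm L A k) : L =O[𝓝 0] fun u => u ^ k := by
  simpa only [sub_add_cancel] using hL.isLittleO.isBigO.add
    ((Asymptotics.isBigO_refl (fun u : ℂ => u ^ k) (𝓝 0)).const_mul_left A)

theorem tendsto_div_pow (hL : HasLeadingTerm L A k) :
    Tendsto (fun u => L u / u ^ k) (𝓝[≠] 0) (𝓝 A) := by
  have hlim : Tendsto (fun u => (L u - A * u ^ k) / u ^ k + A) (𝓝[≠] 0) (𝓝 A) := by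
    simpa only [zero_add] using
      (hL.isLittleO.mono nhdsWithin_le_nhds).tendsto_div_nhds_zero.add_const A
  refine hlim.congr' ?_
  filter_upwards [self_mem_nhdsWithin] with u hu
  rw [sub_div, mul_div_cancel_right₀ _ (pow_ne_zero k hu), sub_add_cancel]

theorem tendsto_zero (hL : HasLeadingTerm L A k) (hk : k ≠ 0) : Tendsto L (𝓝 0) (𝓝 0) :=
  hL.isBigO_pow.trans_tendsto ((continuous_pow k).tendsto' _ _ (zero_pow hk))

theorem apply_zero (hL : HasLeadingTerm L A k) (hk : k ≠ 0) : L 0 = 0 :=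
  hL.isBigO_pow.eq_zero_imp.self_of_nhds (zero_pow hk)

theorem of_hasFPowerSeriesAt {p : FormalMultilinearSeries ℂ ℂ ℂ} (hL : HasFPowerSeriesAt L p 0)
    (hp : ∀ i < k, p.coeff i = 0) : HasLeadingTerm L (p.coeff k) k := by
  refine ⟨hL.analyticAt, ?_⟩
  have hsum (u : ℂ) : p.partialSum (k + 1) u = p.coeff k * u ^ k := by
    rw [FormalMultilinearSeries.partialSum, Finset.sum_range_succ, Finset.sum_eq_zero, zero_add,
      p.apply_eq_pow_smul_coeff, smul_eq_mul, mul_comm]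
    intro i hi
    rw [p.apply_eq_pow_smul_coeff, hp i (Finset.mem_range.1 hi), smul_zero]
  simpa only [zero_add, hsum, ← norm_pow, Asymptotics.isBigO_norm_right] using
    hL.isBigO_sub_partialSum_pow (k + 1)

theorem of_deriv (hL : AnalyticAt ℂ L 0) (h0 : L 0 = 0) : HasLeadingTerm L (deriv L 0) 1 := by
  obtain ⟨p, hp⟩ := hL
  have hcoeff : p.coeff 1 = deriv L 0 := hp.deriv.symm
  rw [← hcoeff]
  refine of_hasFPowerSeriesAt hp fun i hi => ?_
  rw [Nat.lt_one_iff.1 hi, ← h0]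
  exact hp.coeff_zero _

theorem comp {g : ℂ → ℂ} {B : ℂ} (hg : HasLeadingTerm g B 1) (hL : HasLeadingTerm L A k)
    (hk : k ≠ 0) : HasLeadingTerm (fun u => g (L u)) (B * A) k := by
  have hpow : (fun u : ℂ => (u ^ k) ^ (1 + 1)) =O[𝓝 0] fun u => u ^ (k + 1) := by
    have : (fun u : ℂ => u ^ (k - 1)) =O[𝓝 0] fun _ => (1 : ℂ) :=
      (continuous_pow (k - 1)).continuousAt.isBigO_one ℂ
    have hsplit (u : ℂ) : (u ^ k) ^ (1 + 1) = u ^ (k + 1) * u ^ (k - 1) := by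
      rw [← pow_mul, ← pow_add]
      congr 1
      omega
    simpa only [hsplit, mul_one] using (Asymptotics.isBigO_refl _ _).mul this
  refine ⟨.comp (by rw [hL.apply_zero hk]; exact hg.analyticAt) hL.analyticAt, ?_⟩
  have hg' : (fun u => g (L u) - B * L u) =O[𝓝 0] fun u => u ^ (k + 1) := by
    simpa only [Function.comp_def, pow_one] using
      (hg.isBigO.comp_tendsto (hL.tendsto_zero hk)).trans ((hL.isBigO_pow.pow (1 + 1)).trans hpow)
  refine (hg'.add (hL.isBigO.const_mul_left B)).congr_left fun u => ?_
  ring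

end HasLeadingTerm

/-- The branch `τ y^(-1/k)` of the `k`-th roots of `τ^k / y` on the right half plane. -/
noncomputable def rootCoordinate (τ : ℂ) (k : ℕ) (y : ℂ) : ℂ := τ * Complex.exp (-Complex.log y / k)

section RootCoordinate

variable {τ y : ℂ} {k : ℕ}

theorem norm_rootCoordinate (hy : y ≠ 0) :
    ‖rootCoordinate τ k y‖ = ‖τ‖ * ‖y‖ ^ (-(1 / (k : ℝ))) := by
  have hre : (-Complex.log y / k).re = Real.log ‖y‖ * -(1 / (k : ℝ)) := by
    rw [Complex.div_natCast_re, Complex.neg_re, Complex.log_re]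
    ring
  rw [rootCoordinate, norm_mul, Complex.norm_exp, Real.rpow_def_of_pos (norm_pos_iff.2 hy), hre]

theorem rootCoordinate_pow (hk : k ≠ 0) (hy : y ≠ 0) : rootCoordinate τ k y ^ k = τ ^ k / y := by
  rw [rootCoordinate, mul_pow, ← Complex.exp_nat_mul, mul_div_cancel₀ _ (Nat.cast_ne_zero.2 hk),
    Complex.exp_neg, Complex.exp_log hy, div_eq_mul_inv]

theorem differentiableAt_rootCoordinate (hy : y ∈ Complex.slitPlane) :
    DifferentiableAt ℂ (rootCoordinate τ k) y := by
  unfold rootCoordinate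
  have := Complex.differentiableAt_log hy
  fun_prop

theorem eventually_re_pos : ∀ᶠ y in comap Complex.re atTop, 0 < y.re :=
  preimage_mem_comap (Ioi_mem_atTop 0)

theorem tendsto_rootCoordinate (hk : k ≠ 0) :
    Tendsto (rootCoordinate τ k) (comap Complex.re atTop) (𝓝 0) := by
  have hk' : 0 < 1 / (k : ℝ) := by positivity
  have hnorm : Tendsto (fun y : ℂ => ‖y‖) (comap Complex.re atTop) atTop :=
    tendsto_atTop_mono Complex.re_le_norm tendsto_comap
  have hlim : Tendsto (fun y : ℂ => ‖τ‖ * ‖y‖ ^ (-(1 / (k : ℝ)))) (comap Complex.re atTop)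
      (𝓝 0) := by
    simpa only [mul_zero, Function.comp_def] using
      ((tendsto_rpow_neg_atTop hk').comp hnorm).const_mul ‖τ‖
  refine squeeze_zero_norm' ?_ hlim
  filter_upwards [eventually_re_pos] with y hy
  exact (norm_rootCoordinate (Complex.ne_zero_of_re_pos hy)).le

theorem exists_eventually_decaysOn {g : ℂ → ℂ} {m : ℕ}
    (hg : ∀ᶠ y in comap Complex.re atTop, DifferentiableAt ℂ g y)
    (hO : g =O[comap Complex.re atTop] fun y => rootCoordinate τ k y ^ m) :
    ∃ C, ∀ᶠ R in atTop, DecaysOn g R C (m / k) := by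
  obtain ⟨c, hc, hbound⟩ := hO.exists_nonneg
  refine ⟨c * ‖τ‖ ^ m, ?_⟩
  filter_upwards [eventually_forall_mem_rightHalfPlane
    (hg.and (hbound.bound.and eventually_re_pos))] with R hR
  refine ⟨fun y hy => (hR y hy).1.differentiableWithinAt, fun y hy => ?_⟩
  obtain ⟨-, hle, hre⟩ := hR y hy
  rw [norm_pow, norm_rootCoordinate (Complex.ne_zero_of_re_pos hre), mul_pow,
    ← Real.rpow_mul_natCast (norm_nonneg y)] at hle
  have hexp : -(1 / (k : ℝ)) * m = -(m / k) := by ring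
  rw [hexp] at hle
  calc ‖g y‖ ≤ c * (‖τ‖ ^ m * ‖y‖ ^ (-(m / k) : ℝ)) := hle
    _ ≤ c * (‖τ‖ ^ m * y.re ^ (-(m / k) : ℝ)) := by
      have := Real.rpow_le_rpow_of_nonpos hre (Complex.re_le_norm y)
        (neg_nonpos.2 (by positivity : (0 : ℝ) ≤ m / k))
      gcongr
    _ = c * ‖τ‖ ^ m * y.re ^ (-(m / k) : ℝ) := (mul_assoc _ _ _).symm

end RootCoordinate

section PetalMap

variable {L : ℂ → ℂ} {A τ : ℂ} {k : ℕ}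

theorem HasLeadingTerm.eventually_differentiableAt_comp_rootCoordinate (hL : HasLeadingTerm L A k)
    (hk : k ≠ 0) :
    ∀ᶠ y in comap Complex.re atTop, DifferentiableAt ℂ (fun y => L (rootCoordinate τ k y)) y := by
  filter_upwards [eventually_re_pos,
    (tendsto_rootCoordinate hk).eventually hL.analyticAt.eventually_analyticAt] with y hy hLy
  exact hLy.differentiableAt.comp y (differentiableAt_rootCoordinate (Or.inl hy))

theorem HasLeadingTerm.isBigO_comp_rootCoordinate_sub (hL : HasLeadingTerm L A k) (hk : k ≠ 0) :
    (fun y => L (rootCoordinate τ k y) - A * τ ^ k / y) =O[comap Complex.re atTop]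
      fun y => rootCoordinate τ k y ^ (k + 1) := by
  refine (hL.isBigO.comp_tendsto (tendsto_rootCoordinate hk)).congr' ?_ .rfl
  filter_upwards [eventually_re_pos] with y hy
  simp only [Function.comp_apply, rootCoordinate_pow hk (Complex.ne_zero_of_re_pos hy),
    mul_div_assoc]

theorem HasLeadingTerm.exists_eventually_decaysOn (hL : HasLeadingTerm L 0 k) (hk : k ≠ 0) :
    ∃ C, ∀ᶠ R in atTop, DecaysOn (fun y => L (rootCoordinate τ k y)) R C ((k + 1 : ℕ) / k) := by
  refine _root_.exists_eventually_decaysOn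
    (hL.eventually_differentiableAt_comp_rootCoordinate hk) (τ := τ) ?_
  simpa only [zero_mul, zero_div, sub_zero] using hL.isBigO_comp_rootCoordinate_sub (τ := τ) hk

/-- The map induced on `y`, where `u = τ y^(-1/k)`, by the map `u ↦ u exp (S u)`. -/
noncomputable def petalMap (S : ℂ → ℂ) (τ : ℂ) (k : ℕ) (y : ℂ) : ℂ :=
  y * Complex.exp (-k * S (rootCoordinate τ k y))

variable {S : ℂ → ℂ} {Λ : ℂ}

theorem log_mul_exp {y x : ℂ} (hy : 0 < y.re) (hx : ‖x‖ ≤ 1) :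
    Complex.log (y * Complex.exp x) = Complex.log y + x := by
  have harg := abs_lt.1 (Complex.abs_arg_lt_pi_div_two_iff.2 (Or.inl hy))
  have him := abs_le.1 ((Complex.abs_im_le_norm x).trans hx)
  have hπ := Real.pi_gt_three
  have hexp : y * Complex.exp x = Complex.exp (Complex.log y + x) := by
    rw [Complex.exp_add, Complex.exp_log (Complex.ne_zero_of_re_pos hy)]
  rw [hexp, Complex.log_exp] <;> rw [Complex.add_im, Complex.log_im] <;> linarith

theorem eventually_log_petalMap (hS : HasLeadingTerm S Λ k) (hk : k ≠ 0) :
    ∀ᶠ y in comap Complex.re atTop,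
      Complex.log (petalMap S τ k y) = Complex.log y + -k * S (rootCoordinate τ k y) := by
  have hlim : Tendsto (fun y => -k * S (rootCoordinate τ k y)) (comap Complex.re atTop) (𝓝 0) :=
    ((hS.const_mul (-k)).tendsto_zero hk).comp (tendsto_rootCoordinate hk)
  filter_upwards [eventually_re_pos, hlim.eventually (Metric.closedBall_mem_nhds 0 one_pos)]
    with y hy hx
  exact log_mul_exp hy (mem_closedBall_zero_iff.1 hx)

theorem hasLeadingTerm_exp_sub_one : HasLeadingTerm (fun v => Complex.exp v - 1) 1 1 := by
  have hderiv : deriv (fun v => Complex.exp v - 1) 0 = 1 := by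
    rw [deriv_sub_const, Complex.deriv_exp, Complex.exp_zero]
  simpa only [hderiv] using HasLeadingTerm.of_deriv
    (L := fun v => Complex.exp v - 1) (by fun_prop) (by rw [Complex.exp_zero, sub_self])

theorem exists_eventually_decaysOn_translationError (hS : HasLeadingTerm S Λ k) (hk : k ≠ 0)
    (hτ : k * Λ * τ ^ k = -1) :
    ∃ C, ∀ᶠ R in atTop, DecaysOn (translationError (petalMap S τ k)) R C ((1 : ℕ) / k) := by
  set u := rootCoordinate τ k
  have hE : HasLeadingTerm (fun v => Complex.exp (-k * S v) - 1) (-(k * Λ)) k := by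
    simpa only [one_mul, neg_mul] using hasLeadingTerm_exp_sub_one.comp (hS.const_mul (-k)) hk
  have herror : translationError (petalMap S τ k) =
      fun y => y * (Complex.exp (-k * S (u y)) - 1) - 1 := by
    ext y
    rw [translationError, petalMap, mul_sub, mul_one]
  rw [herror]
  refine exists_eventually_decaysOn (τ := τ) ?_ ?_
  · filter_upwards [hE.eventually_differentiableAt_comp_rootCoordinate hk] with y hy
    exact (differentiableAt_id.fun_mul hy).sub_const 1
  have hO := (Asymptotics.isBigO_refl (fun y : ℂ => y) _).mul
    (hE.isBigO_comp_rootCoordinate_sub (τ := τ) hk)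
  refine (hO.congr' ?_ ?_).trans (Asymptotics.isBigO_const_mul_self (τ ^ k) (fun y => u y ^ 1) _)
  · filter_upwards [eventually_re_pos] with y hy
    have hy0 := Complex.ne_zero_of_re_pos hy
    rw [neg_mul (_ * Λ), hτ, neg_neg, mul_sub, mul_one_div_cancel hy0]
  · filter_upwards [eventually_re_pos] with y hy
    have hy0 := Complex.ne_zero_of_re_pos hy
    rw [pow_succ, rootCoordinate_pow hk hy0, ← mul_assoc, mul_div_cancel₀ _ hy0, pow_one]

end PetalMap

/-- The function `w` of the Fatou coordinate `ψ` such that `w (ψ + 1) - w ψ = iθ - c x + g`, where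
`log (f y) = log y + x` at the point `y = χ ψ`: a logarithm of a coordinate of the orbits in a
petal. -/
noncomputable def logCoordinate (f χ g : ℂ → ℂ) (c : ℂ) (θ : ℝ) (ψ : ℂ) : ℂ :=
  Complex.I * θ * ψ - c * Complex.log (χ ψ) + cohomologicalSolution f g (χ ψ)

section LogCoordinate

variable {f χ g : ℂ → ℂ} {R R' C p θ : ℝ} {c : ℂ}

theorem differentiableOn_logCoordinate (hχ : IsFatouParametrization f χ R R') (hR : 0 < R)
    (hg : DecaysOn g R C p) (hp : 1 < p) :
    DifferentiableOn ℂ (logCoordinate f χ g c θ) (halfStrip R') := by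
  have hlog : DifferentiableOn ℂ (fun ψ => Complex.log (χ ψ)) (halfStrip R') :=
    hχ.differentiableOn.clog fun ψ hψ => Or.inl (hR.trans (hχ.mapsTo hψ))
  have hsol : DifferentiableOn ℂ (fun ψ => cohomologicalSolution f g (χ ψ)) (halfStrip R') :=
    (differentiableOn_cohomologicalSolution hχ.movesRight hg hR hp).comp hχ.differentiableOn
      hχ.mapsTo
  unfold logCoordinate
  fun_prop

theorem logCoordinate_add_one (hχ : IsFatouParametrization f χ R R') (hR : 0 < R)
    (hg : DecaysOn g R C p) (hp : 1 < p) {ψ x : ℂ} (hψ : ψ ∈ halfStrip R')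
    (hx : Complex.log (f (χ ψ)) = Complex.log (χ ψ) + x) :
    logCoordinate f χ g c θ (ψ + 1) =
      logCoordinate f χ g c θ ψ + Complex.I * θ + (g (χ ψ) - c * x) := by
  simp only [logCoordinate, hχ.map_add_one ψ hψ, hx,
    cohomologicalSolution_comp hχ.movesRight hg hR hp (hχ.mapsTo hψ)]
  ring

theorem re_logCoordinate_le (hχ : IsFatouParametrization f χ R R') (hR : 0 < R)
    (hg : DecaysOn g R C p) (hp : 1 < p) (hc : 0 ≤ c.re) {ψ : ℂ} (hψ : ψ ∈ halfStrip R') :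
    (logCoordinate f χ g c θ ψ).re ≤ |θ| + |c.im| * Real.pi
      + C * ∑' l : ℕ, (R + (l : ℝ) / 2) ^ (-p) - c.re * Real.log (χ ψ).re := by
  have hpos : 0 < (χ ψ).re := hR.trans (hχ.mapsTo hψ)
  have hrotation : (Complex.I * θ * ψ).re ≤ |θ| := by
    have hre : (Complex.I * θ * ψ).re = -(θ * ψ.im) := by simp [Complex.mul_re]
    rw [hre]
    refine (neg_le_abs _).trans ?_
    rw [abs_mul]
    exact mul_le_of_le_one_right (abs_nonneg _) hψ.2.le
  have harg : c.im * (χ ψ).arg ≤ |c.im| * Real.pi := by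
    refine (le_abs_self _).trans ?_
    rw [abs_mul]
    exact mul_le_mul_of_nonneg_left (Complex.abs_arg_le_pi _) (abs_nonneg _)
  have hlog : c.re * Real.log (χ ψ).re ≤ c.re * Real.log ‖χ ψ‖ :=
    mul_le_mul_of_nonneg_left (Real.log_le_log hpos (Complex.re_le_norm _)) hc
  have hsol := (Complex.re_le_norm _).trans
    (norm_cohomologicalSolution_le hχ.movesRight hg hR hp (hχ.mapsTo hψ))
  rw [tsum_mul_left] at hsol
  rw [logCoordinate, Complex.add_re, Complex.sub_re, Complex.mul_re c, Complex.log_re,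
    Complex.log_im]
  linarith

theorem tendsto_re_logCoordinate (hχ : IsFatouParametrization f χ R R') (hR : 0 < R)
    (hg : DecaysOn g R C p) (hp : 1 < p) (hc : 0 < c.re) {ψ : ℂ} (hψ : ψ ∈ halfStrip R') :
    Tendsto (fun l : ℕ => (logCoordinate f χ g c θ (ψ + l)).re) atTop atBot := by
  refine tendsto_atBot_mono (fun l =>
    re_logCoordinate_le hχ hR hg hp hc.le (add_natCast_mem_halfStrip hψ l)) ?_
  exact tendsto_const_nhds.add_atBot (tendsto_neg_atTop_atBot.comp
    ((Real.tendsto_log_atTop.comp (hχ.tendsto_re hψ)).const_mul_atTop hc))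

theorem eventually_re_logCoordinate_le (hg : ∀ᶠ R in atTop, DecaysOn g R C p) (hp : 1 < p)
    (hc : 0 < c.re) (θ B : ℝ) : ∀ᶠ R in atTop, ∀ χ R', IsFatouParametrization f χ R R' →
      ∀ ψ ∈ halfStrip R', (logCoordinate f χ g c θ ψ).re ≤ B := by
  have hlim : Tendsto (fun R : ℝ => |θ| + |c.im| * Real.pi
      + C * ∑' l : ℕ, (R + (l : ℝ) / 2) ^ (-p) - c.re * Real.log R) atTop atBot :=
    (((tendsto_tsum_add_half_rpow_neg hp).const_mul C).const_add _).add_atBot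
      (tendsto_neg_atTop_atBot.comp (Real.tendsto_log_atTop.const_mul_atTop hc))
  filter_upwards [hg, eventually_gt_atTop 0, hlim.eventually_le_atBot B]
    with R hgR hR hB χ R' hχ ψ hψ
  have hlog : c.re * Real.log R ≤ c.re * Real.log (χ ψ).re :=
    mul_le_mul_of_nonneg_left (Real.log_le_log hR (hχ.mapsTo hψ).le) hc.le
  linarith [re_logCoordinate_le (θ := θ) hχ hR hgR hp hc.le hψ]

theorem sum_mul_logCoordinate {ι : Type*} [Fintype ι] {g : ι → ℂ → ℂ} {C : ι → ℝ}
    {θ : ι → ℝ} {α c : ι → ℂ} (hχ : IsFatouParametrization f χ R R') (hR : 0 < R)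
    (hg : ∀ j, DecaysOn (g j) R (C j) p) (hp : 1 < p) (hsum : ∀ y, ∑ j, α j * g j y = 0)
    {ψ : ℂ} (hψ : ψ ∈ halfStrip R') :
    ∑ j, α j * logCoordinate f χ (g j) (c j) (θ j) ψ =
      Complex.I * (∑ j, α j * θ j) * ψ - (∑ j, α j * c j) * Complex.log (χ ψ) := by
  have hsol : ∑ j, α j * cohomologicalSolution f (g j) (χ ψ) = 0 := by
    have hsummable (j : ι) : Summable (fun l : ℕ => α j * g j (f^[l] (χ ψ))) :=
      (summable_comp_iterate hχ.movesRight (hg j) hR hp (hχ.mapsTo hψ)).mul_left _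
    simp only [cohomologicalSolution, mul_neg, ← tsum_mul_left]
    rw [Finset.sum_neg_distrib, ← Summable.tsum_finsetSum fun j _ => hsummable j]
    simp only [hsum, tsum_zero, neg_zero]
  simp only [logCoordinate, mul_add, mul_sub, Finset.sum_add_distrib, Finset.sum_sub_distrib, hsol]
  simp only [Finset.sum_mul, Finset.mul_sum, add_zero]
  congr 1 <;> exact Finset.sum_congr rfl fun j _ => by ring

end LogCoordinate

/-- The coordinates of the orbits in an attracting petal: for `ψ` in a half strip, the points
`(e^{w₁ ψ}, …, e^{wₙ ψ})` have resonant monomial `e^{Y ψ}`, and, up to the rotations `θ`, the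
translation `ψ ↦ ψ + 1` multiplies their coordinates by `exp (L j u)`, where `u = τ e^{Y ψ}`. -/
structure IsPetalCoordinates {ι : Type*} [Fintype ι] (L : ι → ℂ → ℂ) (α : ι → ℂ)
    (θ : ι → ℝ) (τ : ℂ) (R B : ℝ) (w : ι → ℂ → ℂ) (Y : ℂ → ℂ) : Prop where
  differentiableOn : ∀ j, DifferentiableOn ℂ (w j) (halfStrip R)
  injOn_exp : InjOn (fun ψ => Complex.exp (Y ψ)) (halfStrip R)
  deriv_ne_zero : ∀ ψ ∈ halfStrip R, deriv Y ψ ≠ 0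
  sum_eq : ∀ ψ ∈ halfStrip R, ∑ j, α j * w j ψ = Y ψ
  add_one : ∀ ψ ∈ halfStrip R, ∀ j,
    w j (ψ + 1) = w j ψ + Complex.I * θ j + L j (τ * Complex.exp (Y ψ))
  re_le : ∀ ψ ∈ halfStrip R, ∀ j, (w j ψ).re ≤ B
  tendsto_re : ∀ ψ ∈ halfStrip R, ∀ j, Tendsto (fun l : ℕ => (w j (ψ + l)).re) atTop atBot

section PetalCoordinates

theorem injOn_exp_neg_log_div {f χ : ℂ → ℂ} {R R' : ℝ} {k : ℕ}
    (hχ : IsFatouParametrization f χ R R') (hR : 0 ≤ R) (hk : k ≠ 0) :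
    InjOn (fun ψ => Complex.exp (-Complex.log (χ ψ) / k)) (halfStrip R') := by
  intro ψ hψ ψ' hψ' h
  have hpow (ψ) (hψ : ψ ∈ halfStrip R') :
      rootCoordinate 1 k (χ ψ) ^ k = 1 / χ ψ := by
    rw [rootCoordinate_pow hk (Complex.ne_zero_of_re_pos (hR.trans_lt (hχ.mapsTo hψ))), one_pow]
  refine hχ.injOn hψ hψ' (inv_injective ?_)
  rw [← one_div, ← one_div, ← hpow ψ hψ, ← hpow ψ' hψ']
  exact congrArg (fun v => (1 * v) ^ k) h

theorem deriv_neg_log_div_ne_zero {f χ : ℂ → ℂ} {R R' : ℝ} {k : ℕ}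
    (hχ : IsFatouParametrization f χ R R') (hR : 0 ≤ R) (hk : k ≠ 0) {ψ : ℂ}
    (hψ : ψ ∈ halfStrip R') : deriv (fun ψ => -Complex.log (χ ψ) / k) ψ ≠ 0 := by
  have hpos : 0 < (χ ψ).re := hR.trans_lt (hχ.mapsTo hψ)
  have hderiv := (hχ.differentiableOn.differentiableAt
    ((isOpen_halfStrip R').mem_nhds hψ)).hasDerivAt
  rw [((hderiv.clog (Or.inl hpos)).fun_neg.div_const (k : ℂ)).deriv]
  exact div_ne_zero (neg_ne_zero.2 (div_ne_zero (hχ.deriv_ne_zero ψ hψ)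
    (Complex.ne_zero_of_re_pos hpos))) (Nat.cast_ne_zero.2 hk)

theorem sum_mul_sub_div_mul_sum {ι : Type*} [Fintype ι] {α A : ι → ℂ} {Λ : ℂ}
    (hΛ : ∑ j, α j * A j = Λ) (hΛ0 : Λ ≠ 0) (l : ι → ℂ) :
    ∑ j, α j * (l j - A j / Λ * ∑ i, α i * l i) = 0 := by
  have hsplit (j : ι) : α j * (l j - A j / Λ * ∑ i, α i * l i)
      = α j * l j - α j * A j * ((∑ i, α i * l i) / Λ) := by ring
  simp only [hsplit, Finset.sum_sub_distrib, ← Finset.sum_mul, hΛ, mul_div_cancel₀ _ hΛ0, sub_self]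

variable {ι : Type*} {L : ι → ℂ → ℂ} {A : ι → ℂ} {k : ℕ} {Λ τ : ℂ}

theorem hasLeadingTerm_sub_div_mul (hL : ∀ j, HasLeadingTerm (L j) (A j) k) {S : ℂ → ℂ}
    (hS : HasLeadingTerm S Λ k) (hΛ0 : Λ ≠ 0) (j : ι) :
    HasLeadingTerm (fun u => L j u - A j / Λ * S u) 0 k := by
  simpa only [div_mul_cancel₀ _ hΛ0, sub_self] using (hL j).sub (hS.const_mul (A j / Λ))

variable [Fintype ι] {α : ι → ℂ} {θ : ι → ℝ}

theorem IsFatouParametrization.isPetalCoordinates {f χ S : ℂ → ℂ} {R R' p B : ℝ} {g : ι → ℂ → ℂ}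
    {C : ι → ℝ} {c : ι → ℂ} (hχ : IsFatouParametrization f χ R R') (hR : 0 < R) (hk : k ≠ 0)
    (hlog : ∀ y ∈ rightHalfPlane R,
      Complex.log (f y) = Complex.log y + -k * S (rootCoordinate τ k y))
    (hg : ∀ j, DecaysOn (g j) R (C j) p) (hp : 1 < p) (hsum : ∀ y, ∑ j, α j * g j y = 0)
    (hc : ∀ j, 0 < (c j).re) (hcsum : ∑ j, α j * c j = 1 / k) (hθ : ∑ j, α j * θ j = 0)
    (hL : ∀ j y, L j (rootCoordinate τ k y) = g j y + c j * (k * S (rootCoordinate τ k y)))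
    (hB : ∀ ψ ∈ halfStrip R', ∀ j, (logCoordinate f χ (g j) (c j) (θ j) ψ).re ≤ B) :
    IsPetalCoordinates L α θ τ R' B (fun j => logCoordinate f χ (g j) (c j) (θ j))
      (fun ψ => -Complex.log (χ ψ) / k) where
  differentiableOn j := differentiableOn_logCoordinate hχ hR (hg j) hp
  injOn_exp := injOn_exp_neg_log_div hχ hR.le hk
  deriv_ne_zero ψ hψ := deriv_neg_log_div_ne_zero hχ hR.le hk hψ
  sum_eq ψ hψ := by
    rw [sum_mul_logCoordinate hχ hR hg hp hsum hψ, hcsum, hθ]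
    ring
  add_one ψ hψ j := by
    have hLj := hL j (χ ψ)
    rw [logCoordinate_add_one hχ hR (hg j) hp hψ (hlog _ (hχ.mapsTo hψ)), neg_mul, mul_neg,
      sub_neg_eq_add, ← hLj, rootCoordinate]
  re_le := hB
  tendsto_re ψ hψ j := tendsto_re_logCoordinate hχ hR (hg j) hp (hc j) hψ

/-- The cohomological equations are solvable because subtracting the multiple `A j / Λ` of
`S = ∑ j, α j * L j`, which drives the resonant monomial, cancels the leading term of `L j`. -/
theorem exists_isPetalCoordinates (hL : ∀ j, HasLeadingTerm (L j) (A j) k) (hk : k ≠ 0)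
    (hΛ : ∑ j, α j * A j = Λ) (hΛ0 : Λ ≠ 0) (hA : ∀ j, 0 < (A j / Λ).re)
    (hτ : k * Λ * τ ^ k = -1) (hθ : ∑ j, α j * θ j = 0) (B : ℝ) :
    ∃ R w Y, IsPetalCoordinates L α θ τ R B w Y := by
  set S : ℂ → ℂ := fun u => ∑ j, α j * L j u
  have hS : HasLeadingTerm S Λ k := hΛ ▸ .sum fun j _ => (hL j).const_mul _
  set g : ι → ℂ → ℂ := fun j y =>
    L j (rootCoordinate τ k y) - A j / Λ * S (rootCoordinate τ k y)
  have hc (j) : 0 < (A j / Λ / k).re := by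
    rw [Complex.div_natCast_re]
    exact div_pos (hA j) (by positivity)
  have hcsum : ∑ j, α j * (A j / Λ / k) = 1 / k := by
    simp only [← mul_div_assoc, ← Finset.sum_div, hΛ, div_self hΛ0]
  have hp : 1 < ((k + 1 : ℕ) : ℝ) / k := by
    rw [one_lt_div (by positivity)]
    exact_mod_cast k.lt_succ_self
  obtain ⟨Cf, hf⟩ := exists_eventually_decaysOn_translationError hS hk hτ
  obtain ⟨R₀, hfR₀, hR₀⟩ := (hf.and (eventually_ge_atTop 0)).exists
  choose C hg using fun j => (hasLeadingTerm_sub_div_mul hL hS hΛ0 j).exists_eventually_decaysOn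
    (τ := τ) hk
  obtain ⟨R, ⟨χ, R', hχ⟩, hgR, hlog, hB, hR⟩ :=
    ((eventually_exists_isFatouParametrization hfR₀ hR₀ (by positivity)).and <|
      (eventually_all.2 hg).and <|
      (eventually_forall_mem_rightHalfPlane (eventually_log_petalMap hS hk)).and <|
      (eventually_all.2 fun j => eventually_re_logCoordinate_le (hg j) hp (hc j) (θ j) B).and <|
      eventually_gt_atTop 0).exists
  refine ⟨R', _, _, hχ.isPetalCoordinates hR hk hlog hgR hp
    (fun y => sum_mul_sub_div_mul_sum hΛ hΛ0 _) hc hcsum hθ (fun j y => ?_)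
    fun ψ hψ j => hB j χ R' hχ ψ hψ⟩
  field_simp
  ring

end PetalCoordinates

/-! ### One-resonant normal forms -/

theorem exists_hasLeadingTerm_hasSum {c : ℕ → ℂ} {T : ℂ} (hT : T ≠ 0)
    (hc : Summable fun i => c i * T ^ i) {k : ℕ} (hk : ∀ i < k, c i = 0) :
    ∃ M, HasLeadingTerm M (c k) k ∧ ∀ᶠ u in 𝓝 0, HasSum (fun i => c i * u ^ i) (M u) := by
  set p := FormalMultilinearSeries.ofScalars ℂ c
  have hradius : 0 < p.radius := by
    refine lt_of_lt_of_le ?_ (p.le_radius_of_tendsto (r := ‖T‖₊) (l := 0) ?_)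
    · exact_mod_cast nnnorm_pos.2 hT
    · simpa [p, FormalMultilinearSeries.ofScalars_norm] using hc.tendsto_atTop_zero.norm
  have hp := p.hasFPowerSeriesOnBall hradius
  have hcoeff (i : ℕ) : p.coeff i = c i := FormalMultilinearSeries.coeff_ofScalars
  refine ⟨p.sum, ?_, ?_⟩
  · rw [← hcoeff]
    exact .of_hasFPowerSeriesAt hp.hasFPowerSeriesAt fun i hi => (hcoeff i).trans (hk i hi)
  · filter_upwards [Metric.eball_mem_nhds 0 hradius] with u hu
    simpa [hcoeff, mul_comm] using hp.hasSum hu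

theorem hasLeadingTerm_log_one_add : HasLeadingTerm (fun u => Complex.log (1 + u)) 1 1 := by
  have hderiv : HasDerivAt (fun u : ℂ => Complex.log (1 + u)) 1 0 := by
    simpa using ((hasDerivAt_id (0 : ℂ)).const_add 1).clog (by simp)
  have hanalytic : AnalyticAt ℂ (fun u : ℂ => Complex.log (1 + u)) 0 := by
    refine (analyticAt_const.add analyticAt_id).clog ?_
    simp
  simpa only [hderiv.deriv] using HasLeadingTerm.of_deriv hanalytic (by simp)

section MonomialPow

variable {n : ℕ}

theorem continuous_monomialPow (α : Fin n → ℕ) :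
    Continuous fun z : Fin n → ℂ => monomialPow z α := by
  unfold monomialPow
  fun_prop

theorem monomialPow_zero {α : Fin n → ℕ} (hα : α ≠ 0) : monomialPow 0 α = 0 := by
  obtain ⟨i, hi⟩ := Function.ne_iff.1 hα
  exact Finset.prod_eq_zero (Finset.mem_univ i) (zero_pow hi)

theorem tendsto_monomialPow {α : Fin n → ℕ} (hα : α ≠ 0) :
    Tendsto (fun z : Fin n → ℂ => monomialPow z α) (𝓝 0) (𝓝 0) :=
  (continuous_monomialPow α).tendsto' 0 0 (monomialPow_zero hα)

theorem ne_zero_of_monomialPow_ne_zero {z : Fin n → ℂ} {α : Fin n → ℕ} {j : Fin n}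
    (h : monomialPow z α ≠ 0) (hj : α j ≠ 0) : z j ≠ 0 := fun h0 =>
  h (Finset.prod_eq_zero (Finset.mem_univ j) (by rw [h0, zero_pow hj]))

theorem monomialPow_mul (z w : Fin n → ℂ) (α : Fin n → ℕ) :
    monomialPow (fun j => z j * w j) α = monomialPow z α * monomialPow w α := by
  simp only [monomialPow, mul_pow, Finset.prod_mul_distrib]

theorem monomialPow_exp (w : Fin n → ℂ) (α : Fin n → ℕ) :
    monomialPow (fun j => Complex.exp (w j)) α = Complex.exp (∑ j, α j * w j) := by
  simp only [monomialPow, Complex.exp_sum, ← Complex.exp_nat_mul]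

end MonomialPow

section LogMultiplier

variable {n : ℕ} {lam : Fin n → ℂ} {α : Fin n → ℕ} {a : Fin n → ℕ → ℂ}
  {F : (Fin n → ℂ) → Fin n → ℂ}

theorem exists_ne_zero_summable_normalForm
    (hF : ∀ᶠ z in 𝓝 (0 : Fin n → ℂ), ∀ j,
      HasSum (fun k : ℕ => a j (k + 1) * monomialPow z α ^ (k + 1) * z j) (F z j - lam j * z j)) :
    ∃ T : ℂ, T ≠ 0 ∧ ∀ j, Summable fun k : ℕ => a j (k + 1) * T ^ (k + 1) := by
  have hdiag : Tendsto (fun t : ℂ => fun _ : Fin n => t) (𝓝[≠] 0) (𝓝 0) :=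
    ((by fun_prop : Continuous fun t : ℂ => fun _ : Fin n => t).tendsto' 0 0 rfl).mono_left
      nhdsWithin_le_nhds
  obtain ⟨t, ht, ht0⟩ := ((hdiag.eventually hF).and self_mem_nhdsWithin).exists
  exact ⟨monomialPow (fun _ => t) α, Finset.prod_ne_zero_iff.2 fun i _ => pow_ne_zero _ ht0,
    fun j => (summable_mul_right_iff ht0).1 (ht j).summable⟩

theorem exists_logMultipliers {k₀ : ℕ} (hlam : ∀ j, lam j ≠ 0) (hα : α ≠ 0)
    (hk₀ : IsWeightedOrder a k₀)
    (hF : ∀ᶠ z in 𝓝 (0 : Fin n → ℂ), ∀ j,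
      HasSum (fun k : ℕ => a j (k + 1) * monomialPow z α ^ (k + 1) * z j) (F z j - lam j * z j)) :
    ∃ L : Fin n → ℂ → ℂ, (∀ j, HasLeadingTerm (L j) (a j k₀ / lam j) k₀) ∧
      ∀ᶠ z in 𝓝 0, ∀ j, F z j = lam j * z j * Complex.exp (L j (monomialPow z α)) := by
  set c : Fin n → ℕ → ℂ := fun j i => if i = 0 then 0 else a j i / lam j
  have hk₀0 : k₀ ≠ 0 := Nat.one_le_iff_ne_zero.1 hk₀.1.1
  have hc_lt (j : Fin n) (i : ℕ) (hi : i < k₀) : c j i = 0 := by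
    by_contra hne
    obtain ⟨hi0, ha⟩ := ite_ne_left_iff.1 hne
    exact hi.not_ge (hk₀.2 ⟨Nat.one_le_iff_ne_zero.2 hi0, j, (div_ne_zero_iff.1 ha.symm).1⟩)
  obtain ⟨T, hT0, hT⟩ := exists_ne_zero_summable_normalForm hF
  have hc_summable (j : Fin n) : Summable fun i => c j i * T ^ i := by
    rw [← summable_nat_add_iff 1]
    simpa only [c, Nat.add_one_ne_zero, if_false, div_mul_eq_mul_div] using (hT j).div_const (lam j)
  choose M hM hMsum using fun j => exists_hasLeadingTerm_hasSum hT0 (hc_summable j) (hc_lt j)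
  refine ⟨fun j u => Complex.log (1 + M j u), fun j => ?_, ?_⟩
  · simpa only [c, if_neg hk₀0, one_mul, Function.comp_def] using
      hasLeadingTerm_log_one_add.comp (hM j) hk₀0
  have hu := tendsto_monomialPow hα
  filter_upwards [hF, hu.eventually (eventually_all.2 hMsum), hu.eventually <| eventually_all.2
    fun j => ((hM j).tendsto_zero hk₀0).eventually_ne (neg_ne_zero.2 one_ne_zero).symm]
    with z hFz hMz hne j
  have hsum : HasSum (fun i => a j (i + 1) * monomialPow z α ^ (i + 1) * z j)
      (lam j * M j (monomialPow z α) * z j) := by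
    have := (hasSum_nat_add_iff' 1).2 (hMz j)
    simp only [Finset.sum_range_one, c, if_true, zero_mul, sub_zero, Nat.add_one_ne_zero, if_false,
      div_mul_eq_mul_div] at this
    simpa only [mul_div_cancel₀ _ (hlam j)] using (this.mul_left (lam j)).mul_right (z j)
  rw [Complex.exp_log fun h0 => hne j (eq_neg_of_add_eq_zero_right h0)]
  linear_combination (hFz j).unique hsum

end LogMultiplier

/-! ### Repelling coordinates -/

/-- In the coordinate `1 / u ^ k` the map `u ↦ u * exp (S u)` is asymptotically the translation by
`-k * Λ`, so the rate of convergence follows by Cesàro averaging. -/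
theorem tendsto_natCast_mul_pow {S : ℂ → ℂ} {Λ : ℂ} {k : ℕ} {u : ℕ → ℂ}
    (hS : HasLeadingTerm S Λ k) (hk : k ≠ 0) (hΛ : Λ ≠ 0) (hu : ∀ l, u l ≠ 0)
    (hstep : ∀ l, u (l + 1) = u l * Complex.exp (S (u l))) (hlim : Tendsto u atTop (𝓝 0)) :
    Tendsto (fun N : ℕ => N * u N ^ k) atTop (𝓝 (-k * Λ)⁻¹) := by
  have hlim' : Tendsto u atTop (𝓝[≠] 0) :=
    tendsto_nhdsWithin_iff.2 ⟨hlim, Eventually.of_forall hu⟩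
  have hdiff : Tendsto (fun l => (u (l + 1) ^ k)⁻¹ - (u l ^ k)⁻¹) atTop (𝓝 (-k * Λ)) := by
    have hexp := hasLeadingTerm_exp_sub_one.comp (hS.const_mul (-k)) hk
    rw [one_mul] at hexp
    refine (hexp.tendsto_div_pow.comp hlim').congr fun l => ?_
    rw [Function.comp_apply, hstep, mul_pow, mul_inv, ← Complex.exp_nat_mul, ← Complex.exp_neg,
      neg_mul]
    ring
  have hmean : Tendsto (fun N : ℕ => (N : ℂ)⁻¹ * (u N ^ k)⁻¹) atTop (𝓝 (-k * Λ)) := by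
    have hinit := (tendsto_inv_atTop_nhds_zero_nat (𝕜 := ℂ)).mul_const (u 0 ^ k)⁻¹
    rw [zero_mul] at hinit
    refine (add_zero (-k * Λ) ▸ hdiff.cesaro_smul.add hinit).congr fun N => ?_
    rw [Finset.sum_range_sub (fun l => (u l ^ k)⁻¹), Complex.real_smul, Complex.ofReal_inv,
      Complex.ofReal_natCast, ← mul_add, sub_add_cancel]
  refine (hmean.inv₀ (mul_ne_zero (neg_ne_zero.2 (Nat.cast_ne_zero.2 hk)) hΛ)).congr fun N => ?_
  rw [mul_inv, inv_inv, inv_inv]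

theorem eventually_re_pos_of_re_div_neg {L S : ℂ → ℂ} {A Λ : ℂ} {k : ℕ} {u : ℕ → ℂ}
    (hL : HasLeadingTerm L A k) (hS : HasLeadingTerm S Λ k) (hk : k ≠ 0) (hΛ : Λ ≠ 0)
    (hA : (A / Λ).re < 0) (hu : ∀ l, u l ≠ 0)
    (hstep : ∀ l, u (l + 1) = u l * Complex.exp (S (u l))) (hlim : Tendsto u atTop (𝓝 0)) :
    ∀ᶠ N in atTop, 0 < (L (u N)).re := by
  have hquot := hL.tendsto_div_pow.comp (tendsto_nhdsWithin_iff.2 ⟨hlim, Eventually.of_forall hu⟩)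
  have hmul : Tendsto (fun N : ℕ => (N : ℂ) * L (u N)) atTop (𝓝 (-(A / Λ) / k)) := by
    have hprod := (tendsto_natCast_mul_pow hS hk hΛ hu hstep hlim).mul hquot
    rw [show (-k * Λ)⁻¹ * A = -(A / Λ) / k by field_simp] at hprod
    refine hprod.congr fun N => ?_
    rw [Function.comp_apply, mul_assoc, mul_div_cancel₀ _ (pow_ne_zero k (hu N))]
  have hpos : 0 < (-(A / Λ) / k).re := by
    rw [Complex.div_natCast_re, Complex.neg_re]
    exact div_pos (neg_pos.2 hA) (by positivity)
  filter_upwards [((Complex.continuous_re.tendsto _).comp hmul).eventually_const_lt hpos] with N hN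
  rw [Function.comp_apply, ← Complex.ofReal_natCast, Complex.re_ofReal_mul] at hN
  exact pos_of_mul_pos_right hN N.cast_nonneg

section NormalFormOrbit

variable {n : ℕ} {lam : Fin n → ℂ} {α : Fin n → ℕ} {L : Fin n → ℂ → ℂ} {z : ℕ → Fin n → ℂ}

theorem monomialPow_mul_mul_exp (hlam : monomialPow lam α = 1) (z : Fin n → ℂ) (l : Fin n → ℂ) :
    monomialPow (fun j => lam j * z j * Complex.exp (l j)) α
      = monomialPow z α * Complex.exp (∑ j, α j * l j) := by
  rw [monomialPow_mul, monomialPow_mul, monomialPow_exp, hlam, one_mul]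

theorem norm_mul_mul_exp {c : ℂ} (hc : ‖c‖ = 1) (z l : ℂ) :
    ‖c * z * Complex.exp l‖ = ‖z‖ * Real.exp l.re := by
  rw [norm_mul, norm_mul, hc, one_mul, Complex.norm_exp]

theorem eq_zero_of_monomialPow_eq_zero (hL : ∀ j, L j 0 = 0) (hmod : ∀ j, ‖lam j‖ = 1)
    (hz : ∀ l j, z (l + 1) j = lam j * z l j * Complex.exp (L j (monomialPow (z l) α)))
    (hu : ∀ l, monomialPow (z l) α = 0) (hlim : Tendsto z atTop (𝓝 0)) : z 0 = 0 := by
  ext j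
  have hnorm (l : ℕ) : ‖z l j‖ = ‖z 0 j‖ := by
    induction l with
    | zero => rfl
    | succ l ih => rw [hz, norm_mul_mul_exp (hmod j), hu, hL, Complex.zero_re, Real.exp_zero,
        mul_one, ih]
  have hconst := (tendsto_pi_nhds.1 hlim j).norm
  simp only [hnorm, Pi.zero_apply, norm_zero] at hconst
  exact norm_eq_zero.1 (tendsto_nhds_unique tendsto_const_nhds hconst)

theorem apply_eq_zero_of_re_pos (hmod : ∀ j, ‖lam j‖ = 1)
    (hz : ∀ l j, z (l + 1) j = lam j * z l j * Complex.exp (L j (monomialPow (z l) α))) {h : Fin n}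
    (hpos : ∀ᶠ l in atTop, 0 < (L h (monomialPow (z l) α)).re) (hlim : Tendsto z atTop (𝓝 0)) :
    ∃ N, z N h = 0 := by
  obtain ⟨N, hN⟩ := eventually_atTop.1 hpos
  have hmono (l : ℕ) (hl : N ≤ l) : ‖z N h‖ ≤ ‖z l h‖ := by
    induction l, hl using Nat.le_induction with
    | base => exact le_rfl
    | succ l hl ih =>
      rw [hz, norm_mul_mul_exp (hmod h)]
      exact ih.trans (le_mul_of_one_le_right (norm_nonneg _) (Real.one_le_exp (hN l hl).le))
  have hlim_norm := (tendsto_pi_nhds.1 hlim h).norm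
  rw [Pi.zero_apply, norm_zero] at hlim_norm
  exact ⟨N, norm_le_zero_iff.1 (ge_of_tendsto hlim_norm (eventually_atTop.2 ⟨N, hmono⟩))⟩

theorem eq_zero_of_tendsto_zero {A : Fin n → ℂ} {k : ℕ} {Λ : ℂ}
    (hL : ∀ j, HasLeadingTerm (L j) (A j) k) (hk : k ≠ 0) (hmod : ∀ j, ‖lam j‖ = 1)
    (hlam : monomialPow lam α = 1) (hΛ : ∑ j, α j * A j = Λ) (hΛ0 : Λ ≠ 0) {h : Fin n}
    (hαh : α h ≠ 0) (hAh : (A h / Λ).re < 0)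
    (hz : ∀ l j, z (l + 1) j = lam j * z l j * Complex.exp (L j (monomialPow (z l) α)))
    (hlim : Tendsto z atTop (𝓝 0)) : z 0 = 0 := by
  set S : ℂ → ℂ := fun v => ∑ j, α j * L j v
  have hS : HasLeadingTerm S Λ k := hΛ ▸ .sum fun j _ => (hL j).const_mul _
  have hstep (l : ℕ) :
      monomialPow (z (l + 1)) α = monomialPow (z l) α * Complex.exp (S (monomialPow (z l) α)) := by
    rw [funext (hz l), monomialPow_mul_mul_exp hlam]
  by_cases hu0 : monomialPow (z 0) α = 0
  · have hu (l : ℕ) : monomialPow (z l) α = 0 := by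
      induction l with
      | zero => exact hu0
      | succ l ih => rw [hstep, ih, zero_mul]
    exact eq_zero_of_monomialPow_eq_zero (fun j => (hL j).apply_zero hk) hmod hz hu hlim
  · have hu (l : ℕ) : monomialPow (z l) α ≠ 0 := by
      induction l with
      | zero => exact hu0
      | succ l ih => exact hstep l ▸ mul_ne_zero ih (Complex.exp_ne_zero _)
    have hα : α ≠ 0 := fun h0 => hαh (congrFun h0 h)
    obtain ⟨N, hN⟩ := apply_eq_zero_of_re_pos hmod hz (eventually_re_pos_of_re_div_neg (hL h) hS hk
      hΛ0 hAh hu hstep ((tendsto_monomialPow hα).comp hlim)) hlim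
    exact absurd hN (ne_zero_of_monomialPow_ne_zero (hu N) hαh)

end NormalFormOrbit

/-! ### Normalizing charts -/

/-- On the ball of radius `r`, the chart `Φ` conjugates `G` to the normal form with logarithmic
multipliers `L`. -/
structure IsNormalChart {n : ℕ} (G Φ : OpenPartialHomeomorph (Fin n → ℂ) (Fin n → ℂ))
    (lam : Fin n → ℂ) (α : Fin n → ℕ) (L : Fin n → ℂ → ℂ) (r : ℝ) : Prop where
  r_pos : 0 < r
  mem_target : ∀ z ∈ Metric.ball 0 r, z ∈ Φ.target
  mem_source : ∀ z ∈ Metric.ball 0 r, Φ.symm z ∈ G.source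
  map_mem_source : ∀ z ∈ Metric.ball 0 r, G (Φ.symm z) ∈ Φ.source
  conj : ∀ z ∈ Metric.ball 0 r, ∀ j,
    Φ (G (Φ.symm z)) j = lam j * z j * Complex.exp (L j (monomialPow z α))

section NormalChart

variable {n : ℕ} {G Φ : OpenPartialHomeomorph (Fin n → ℂ) (Fin n → ℂ)}

namespace IsBiholomorphicGerm

theorem zero_mem_target (hΦ : IsBiholomorphicGerm Φ) : (0 : Fin n → ℂ) ∈ Φ.target :=
  hΦ.map_zero ▸ Φ.map_source hΦ.zero_mem_source

theorem symm_zero (hΦ : IsBiholomorphicGerm Φ) : Φ.symm 0 = 0 := by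
  simpa only [hΦ.map_zero] using Φ.left_inv hΦ.zero_mem_source

theorem tendsto_zero (hΦ : IsBiholomorphicGerm Φ) : Tendsto Φ (𝓝 0) (𝓝 0) := by
  simpa only [ContinuousAt, hΦ.map_zero] using Φ.continuousAt hΦ.zero_mem_source

theorem tendsto_symm_zero (hΦ : IsBiholomorphicGerm Φ) : Tendsto Φ.symm (𝓝 0) (𝓝 0) := by
  simpa only [ContinuousAt, hΦ.symm_zero] using Φ.continuousAt_symm hΦ.zero_mem_target

theorem eventually_mem_source (hΦ : IsBiholomorphicGerm Φ) :
    ∀ᶠ z in 𝓝 (0 : Fin n → ℂ), z ∈ Φ.source :=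
  Φ.open_source.mem_nhds hΦ.zero_mem_source

theorem eq_zero_of_iterate_eq_zero (hG : IsBiholomorphicGerm G) {w : Fin n → ℂ}
    (hw : ∀ l : ℕ, G^[l] w ∈ G.source) {l : ℕ} (h : G^[l] w = 0) : w = 0 := by
  induction l with
  | zero => exact h
  | succ l ih =>
    rw [Function.iterate_succ_apply'] at h
    exact ih (G.injOn (hw l) hG.zero_mem_source (h.trans hG.map_zero.symm))

theorem orbitConvergesToOrigin_zero (hG : IsBiholomorphicGerm G) : OrbitConvergesToOrigin G 0 := by
  have hfix (l : ℕ) : G^[l] 0 = 0 := Function.iterate_fixed hG.map_zero l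
  constructor
  · exact fun l => (hfix l).symm ▸ hG.zero_mem_source
  · simpa only [hfix] using tendsto_const_nhds

end IsBiholomorphicGerm

variable {lam : Fin n → ℂ} {α : Fin n → ℕ} {L : Fin n → ℂ → ℂ}

theorem exists_isNormalChart (hG : IsBiholomorphicGerm G) (hΦ : IsBiholomorphicGerm Φ)
    (h : ∀ᶠ z in 𝓝 (0 : Fin n → ℂ), ∀ j,
      Φ (G (Φ.symm z)) j = lam j * z j * Complex.exp (L j (monomialPow z α))) :
    ∃ r, IsNormalChart G Φ lam α L r := by
  obtain ⟨r, hr, hr'⟩ := Metric.eventually_nhds_iff_ball.1 <|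
    (Φ.open_target.eventually_mem hΦ.zero_mem_target).and <|
    (hΦ.tendsto_symm_zero.eventually hG.eventually_mem_source).and <|
    ((hG.tendsto_zero.comp hΦ.tendsto_symm_zero).eventually hΦ.eventually_mem_source).and h
  exact ⟨r, hr, fun z hz => (hr' z hz).1, fun z hz => (hr' z hz).2.1,
    fun z hz => (hr' z hz).2.2.1, fun z hz => (hr' z hz).2.2.2⟩

theorem orbitConvergesToOrigin_iff {A : Fin n → ℂ} {k : ℕ} {r : ℝ} {Λ : ℂ}
    (hG : IsBiholomorphicGerm G) (hΦ : IsBiholomorphicGerm Φ)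
    (hchart : IsNormalChart G Φ lam α L r) (hL : ∀ j, HasLeadingTerm (L j) (A j) k) (hk : k ≠ 0)
    (hmod : ∀ j, ‖lam j‖ = 1) (hlam : monomialPow lam α = 1) (hΛ : ∑ j, α j * A j = Λ)
    (hΛ0 : Λ ≠ 0) {h : Fin n} (hαh : α h ≠ 0) (hAh : (A h / Λ).re < 0) (w : Fin n → ℂ) :
    OrbitConvergesToOrigin G w ↔ w = 0 := by
  refine ⟨fun ⟨hs, hlim⟩ => ?_, fun hw => hw ▸ hG.orbitConvergesToOrigin_zero⟩
  have hΦlim : Tendsto (fun l : ℕ => Φ (G^[l] w)) atTop (𝓝 0) := hΦ.tendsto_zero.comp hlim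
  obtain ⟨N, hN⟩ := eventually_atTop.1 ((hlim.eventually hΦ.eventually_mem_source).and
    (hΦlim.eventually_mem (Metric.ball_mem_nhds 0 hchart.r_pos)))
  have hzero : Φ (G^[0 + N] w) = 0 := by
    refine eq_zero_of_tendsto_zero (z := fun l => Φ (G^[l + N] w)) hL hk hmod hlam hΛ hΛ0 hαh hAh
      (fun l j => ?_) (hΦlim.comp (tendsto_add_atTop_nat N))
    obtain ⟨hsource, hball⟩ := hN (l + N) (Nat.le_add_left N l)
    have hconj := hchart.conj _ hball j
    rwa [Φ.left_inv hsource, ← Function.iterate_succ_apply' G, ← Nat.succ_add] at hconj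
  rw [zero_add] at hzero
  exact hG.eq_zero_of_iterate_eq_zero hs
    (Φ.injOn (hN N le_rfl).1 hΦ.zero_mem_source (hzero.trans hΦ.map_zero.symm))

end NormalChart

/-! ### The resonance relation among the multipliers -/

section Resonance

variable {n : ℕ}

theorem monomialPow_add (z : Fin n → ℂ) (L L' : Fin n → ℕ) :
    monomialPow z (L + L') = monomialPow z L * monomialPow z L' := by
  simp only [monomialPow, Pi.add_apply, pow_add, Finset.prod_mul_distrib]

theorem monomialPow_smul (z : Fin n → ℂ) (i : ℕ) (L : Fin n → ℕ) :
    monomialPow z (i • L) = monomialPow z L ^ i := by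
  simp only [monomialPow, Pi.smul_apply, smul_eq_mul, ← Finset.prod_pow, ← pow_mul, mul_comm i]

theorem monomialPow_pow (z : Fin n → ℂ) (i : ℕ) (L : Fin n → ℕ) :
    monomialPow (fun j => z j ^ i) L = monomialPow z L ^ i := by
  simp only [monomialPow, ← Finset.prod_pow, ← pow_mul, mul_comm i]

theorem monomialPow_single (z : Fin n → ℂ) (j : Fin n) : monomialPow z (Pi.single j 1) = z j := by
  rw [monomialPow, Finset.prod_eq_single_of_mem j (Finset.mem_univ j), Pi.single_eq_same, pow_one]
  intro i _ hi
  rw [Pi.single_eq_of_ne hi, pow_zero]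

variable {G : OpenPartialHomeomorph (Fin n → ℂ) (Fin n → ℂ)} {lam : Fin n → ℂ} {α : Fin n → ℕ}

namespace IsOneResonant

theorem monomialPow_generator (h : IsOneResonant G lam α) (hlam : ∀ j, lam j ≠ 0) :
    monomialPow lam α = 1 := by
  obtain ⟨j, -⟩ := Function.ne_iff.1 h.generator_ne_zero
  have hres : Pi.single j 1 + 1 • α ∈ resonances lam j := by
    rw [h.resonances_eq]
    exact ⟨1, le_rfl, rfl⟩
  have hpow := hres.2
  rw [one_smul, monomialPow_add, monomialPow_single] at hpow
  exact mul_left_cancel₀ (hlam j) (hpow.trans (mul_one _).symm)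

theorem monomialPow_pow_ne_one (h : IsOneResonant G lam α) {d : ℕ} {β : Fin n → ℕ}
    (hβ : α = d • β) {i : ℕ} (hi : 0 < i) (hid : i < d) : monomialPow lam β ^ i ≠ 1 := by
  intro hone
  obtain ⟨j, hj⟩ := Function.ne_iff.1 (hβ ▸ h.generator_ne_zero)
  have hβj : 0 < β j := Nat.pos_of_ne_zero (right_ne_zero_of_mul hj)
  have hres : Pi.single j 1 + i • β ∈ resonances lam j := by
    refine ⟨?_, by rw [monomialPow_add, monomialPow_single, monomialPow_smul, hone, mul_one]⟩
    calc 2 ≤ (Pi.single j 1 + i • β : Fin n → ℕ) j := by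
          rw [Pi.add_apply, Pi.single_eq_same]
          exact Nat.add_le_add_left (Nat.mul_pos hi hβj) 1
      _ ≤ _ := Finset.single_le_sum_of_canonicallyOrdered (Finset.mem_univ j)
  rw [h.resonances_eq] at hres
  obtain ⟨k, hk, hk'⟩ := hres
  have hij := congrFun (add_left_cancel hk') j
  rw [hβ, smul_smul] at hij
  exact hid.not_ge (Nat.eq_of_mul_eq_mul_right hβj hij ▸ Nat.le_mul_of_pos_left d hk)

theorem isPrimitiveRoot (h : IsOneResonant G lam α) (hlam : ∀ j, lam j ≠ 0) {d : ℕ}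
    {β : Fin n → ℕ} (hβ : α = d • β) : IsPrimitiveRoot (monomialPow lam β) d :=
  .mk_of_lt _ (Nat.pos_of_ne_zero fun hd => h.generator_ne_zero (by rw [hβ, hd, zero_smul]))
    (by rw [← monomialPow_smul, ← hβ, h.monomialPow_generator hlam])
    fun _ => h.monomialPow_pow_ne_one hβ

end IsOneResonant

end Resonance

section RootsOfUnity

variable {ι : Type*}

theorem natCast_gcd (s : Finset ι) (α : ι → ℕ) : s.gcd (fun j => (α j : ℤ)) = (s.gcd α : ℕ) := by
  classical
  induction s using Finset.induction_on with
  | empty => rfl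
  | insert j s _ ih =>
    rw [Finset.gcd_insert, Finset.gcd_insert, ih, ← Int.coe_gcd, Int.gcd_natCast_natCast]
    rfl

variable {s : ℕ} {lam : Fin s → ℂ} {α : Fin s → ℕ}

theorem exists_sum_mul_arg_eq (hmod : ∀ j, ‖lam j‖ = 1) (hlam : monomialPow lam α = 1) :
    ∃ p : ℤ, ∑ j, (α j : ℂ) * (lam j).arg = 2 * Real.pi * p := by
  have hexp : Complex.exp (∑ j, α j * ((lam j).arg * Complex.I)) = 1 := by
    rw [← monomialPow_exp, ← hlam]
    congr with j
    simpa only [hmod, Complex.ofReal_one, one_mul] using Complex.norm_mul_exp_arg_mul_I (lam j)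
  obtain ⟨p, hp⟩ := Complex.exp_eq_one_iff.1 hexp
  simp only [← mul_assoc, ← Finset.sum_mul] at hp
  exact ⟨p, mul_right_cancel₀ Complex.I_ne_zero (by rw [hp]; ring)⟩

/-- A Bézout relation for `α` spreads the integer by which the arguments of `lam` miss the
resonance relation over the coordinates, at the cost of `d`-th roots of unity. -/
theorem exists_roots_of_unity (hα : α ≠ 0) (hmod : ∀ j, ‖lam j‖ = 1)
    (hlam : monomialPow lam α = 1) :
    ∃ (θ : Fin s → ℝ) (ζ : Fin s → ℂ), ∑ j, (α j : ℂ) * θ j = 0 ∧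
      (∀ j, lam j = ζ j * Complex.exp (Complex.I * θ j)) ∧ ∀ j, ζ j ^ Finset.univ.gcd α = 1 := by
  set d := Finset.univ.gcd α
  have hd : (d : ℂ) ≠ 0 := Nat.cast_ne_zero.2 fun h0 =>
    hα (funext fun j => Finset.gcd_eq_zero_iff.1 h0 j (Finset.mem_univ j))
  obtain ⟨b, hb⟩ := Finset.gcd_eq_sum_mul Finset.univ fun j => (α j : ℤ)
  have hb' : ∑ j, (α j : ℂ) * b j = d := by
    rw [natCast_gcd] at hb
    exact_mod_cast hb.symm
  obtain ⟨p, hp⟩ := exists_sum_mul_arg_eq hmod hlam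
  refine ⟨fun j => (lam j).arg - 2 * Real.pi * p / d * b j,
    fun j => Complex.exp (b j * p * (2 * Real.pi * Complex.I) / d), ?_, fun j => ?_, fun j => ?_⟩
  · have hsplit (j : Fin s) :
        (α j : ℂ) * ((lam j).arg - 2 * Real.pi * p / d * b j : ℝ)
          = α j * (lam j).arg - 2 * Real.pi * p / d * (α j * b j) := by
      push_cast
      ring
    simp only [hsplit, Finset.sum_sub_distrib, ← Finset.mul_sum, hb', hp, div_mul_cancel₀ _ hd,
      sub_self]
  · have hpolar := Complex.norm_mul_exp_arg_mul_I (lam j)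
    rw [hmod, Complex.ofReal_one, one_mul] at hpolar
    refine hpolar.symm.trans ?_
    rw [← Complex.exp_add]
    congr 1
    push_cast
    ring
  · rw [← Complex.exp_nat_mul, mul_div_cancel₀ _ hd]
    exact_mod_cast Complex.exp_int_mul_two_pi_mul_I (b j * p)

end RootsOfUnity

/-! ### Coordinates on the parabolic manifold -/

/-- The first `s` coordinate axes: `x` padded with zeros to a point of `ℂⁿ`. -/
def firstCoords {s n : ℕ} (x : Fin s → ℂ) (j : Fin n) : ℂ :=
  if h : (j : ℕ) < s then x ⟨j, h⟩ else 0

section FirstCoords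

variable {s n : ℕ}

theorem firstCoords_castLE (h : s ≤ n) (x : Fin s → ℂ) (j : Fin s) :
    firstCoords x (Fin.castLE h j) = x j :=
  dif_pos j.isLt

theorem contDiff_firstCoords : ContDiff ℂ 1 (firstCoords : (Fin s → ℂ) → Fin n → ℂ) := by
  refine contDiff_pi.2 fun j => ?_
  unfold firstCoords
  split_ifs <;> fun_prop

theorem firstCoords_zero : (firstCoords (0 : Fin s → ℂ) : Fin n → ℂ) = 0 :=
  funext fun j => (apply_dite (fun c : ℂ => c = 0) _ _ _).mpr (by split_ifs <;> rfl)

theorem norm_firstCoords_lt {x : Fin s → ℂ} {r : ℝ} (hx : ‖x‖ < r) :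
    ‖(firstCoords x : Fin n → ℂ)‖ < r := by
  have hr := (norm_nonneg x).trans_lt hx
  refine (pi_norm_lt_iff hr).2 fun j => ?_
  unfold firstCoords
  split_ifs with h
  · exact (norm_le_pi_norm x _).trans_lt hx
  · rwa [norm_zero]

@[to_additive]
theorem prod_eq_prod_castLE {M : Type*} [CommMonoid M] (h : s ≤ n) {g : Fin n → M}
    (hg : ∀ j : Fin n, s ≤ (j : ℕ) → g j = 1) : ∏ j, g j = ∏ j : Fin s, g (Fin.castLE h j) :=
  (Finset.prod_of_injOn (Fin.castLE h) (Fin.castLE_injective h).injOn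
    (fun _ _ => Finset.mem_coe.2 (Finset.mem_univ _))
    (fun j _ hj => hg j (le_of_not_gt fun hlt => hj ⟨⟨j, hlt⟩, Finset.mem_coe.2 (Finset.mem_univ _),
      rfl⟩)) fun _ _ => rfl).symm

variable {α : Fin n → ℕ}

theorem monomialPow_eq_castLE (h : s ≤ n) (hα : ∀ j : Fin n, s ≤ (j : ℕ) → α j = 0)
    (z : Fin n → ℂ) :
    monomialPow z α = monomialPow (fun j => z (Fin.castLE h j)) (fun j => α (Fin.castLE h j)) :=
  prod_eq_prod_castLE h fun j hj => by rw [hα j hj, pow_zero]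

theorem gcd_eq_castLE (h : s ≤ n) (hα : ∀ j : Fin n, s ≤ (j : ℕ) → α j = 0) :
    Finset.univ.gcd α = Finset.univ.gcd (fun j : Fin s => α (Fin.castLE h j)) := by
  refine Nat.dvd_antisymm (Finset.dvd_gcd fun j _ => Finset.gcd_dvd (Finset.mem_univ _))
    (Finset.dvd_gcd fun j _ => ?_)
  rcases lt_or_ge (j : ℕ) s with hj | hj
  · exact Finset.gcd_dvd (f := fun j : Fin s => α (Fin.castLE h j)) (Finset.mem_univ ⟨j, hj⟩)
  · exact hα j hj ▸ dvd_zero _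

end FirstCoords

/-- The base of the parabolic manifold: one coordinate ranges over a half strip, the others over
the unit disc. -/
def petalBase {s : ℕ} (j₀ : Fin s) (R : ℝ) : Set (Fin s → ℂ) :=
  Set.pi univ fun j => if j = j₀ then halfStrip R else Metric.ball 0 1

section PetalBase

variable {s : ℕ} {j₀ : Fin s} {R : ℝ} {X : Fin s → ℂ}

theorem mem_petalBase :
    X ∈ petalBase j₀ R ↔ X j₀ ∈ halfStrip R ∧ ∀ j, j ≠ j₀ → ‖X j‖ < 1 := by
  have hmem (j) : (X j ∈ if j = j₀ then halfStrip R else Metric.ball 0 1) ↔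
      (j = j₀ → X j ∈ halfStrip R) ∧ (j ≠ j₀ → ‖X j‖ < 1) := by
    split_ifs with hj <;> simp [hj]
  simp only [petalBase, mem_univ_pi, hmem, forall_and, forall_eq]

theorem isOpen_petalBase : IsOpen (petalBase j₀ R) := by
  refine isOpen_set_pi finite_univ fun j _ => ?_
  split_ifs
  · exact isOpen_halfStrip R
  · exact Metric.isOpen_ball

theorem convex_petalBase : Convex ℝ (petalBase j₀ R) := by
  refine convex_pi fun j _ => ?_
  split_ifs
  · exact convex_halfStrip R
  · exact convex_ball 0 1

theorem petalBase_nonempty : (petalBase j₀ R).Nonempty := by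
  refine ⟨Pi.single j₀ ((R + 1 : ℝ) : ℂ), mem_petalBase.2 ⟨?_, fun j hj => ?_⟩⟩
  · rw [Pi.single_eq_same]
    exact ⟨lt_add_one R, by rw [Complex.ofReal_im, abs_zero]; exact one_pos⟩
  · rw [Pi.single_eq_of_ne hj, norm_zero]
    exact one_pos

theorem add_single_natCast_mem_petalBase (hX : X ∈ petalBase j₀ R) (l : ℕ) :
    X + Pi.single j₀ (l : ℂ) ∈ petalBase j₀ R := by
  rw [mem_petalBase] at hX ⊢
  refine ⟨?_, fun j hj => ?_⟩
  · rw [Pi.add_apply, Pi.single_eq_same]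
    exact add_natCast_mem_halfStrip hX.1 l
  · rw [Pi.add_apply, Pi.single_eq_of_ne hj, add_zero]
    exact hX.2 j hj

end PetalBase

/-- The coordinates `V` with `∑ α_j V_j = c` that agree with `X` away from `j₀`. -/
noncomputable def fiberCoord {s : ℕ} (α : Fin s → ℕ) (j₀ : Fin s) (c : ℂ) (X : Fin s → ℂ)
    (j : Fin s) : ℂ :=
  if j = j₀ then (c - ∑ i ∈ Finset.univ.erase j₀, α i * X i) / α j₀ else X j

section FiberCoord

variable {s : ℕ} {α : Fin s → ℕ} {j₀ : Fin s} {c : ℂ} {X : Fin s → ℂ}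

theorem fiberCoord_of_ne {j : Fin s} (hj : j ≠ j₀) : fiberCoord α j₀ c X j = X j :=
  if_neg hj

theorem sum_fiberCoord (hj₀ : α j₀ ≠ 0) : ∑ j, α j * fiberCoord α j₀ c X j = c := by
  have herase : ∑ j ∈ Finset.univ.erase j₀, α j * fiberCoord α j₀ c X j
      = ∑ j ∈ Finset.univ.erase j₀, α j * X j :=
    Finset.sum_congr rfl fun j hj => by rw [fiberCoord_of_ne (Finset.ne_of_mem_erase hj)]
  rw [← Finset.add_sum_erase _ _ (Finset.mem_univ j₀), herase, fiberCoord, if_pos rfl,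
    mul_div_cancel₀ _ (Nat.cast_ne_zero.2 hj₀), sub_add_cancel]

theorem fiberCoord_add_single (t : ℂ) :
    fiberCoord α j₀ c (X + Pi.single j₀ t) = fiberCoord α j₀ c X := by
  have hne (j : Fin s) (hj : j ≠ j₀) : (X + Pi.single j₀ t : Fin s → ℂ) j = X j := by
    rw [Pi.add_apply, Pi.single_eq_of_ne hj, add_zero]
  ext j
  unfold fiberCoord
  split_ifs with hj
  · rw [Finset.sum_congr rfl fun i hi => by rw [hne i (Finset.ne_of_mem_erase hi)]]
  · exact hne j hj

theorem contDiff_fiberCoord (j : Fin s) : ContDiff ℂ 1 (fun X => fiberCoord α j₀ c X j) := by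
  unfold fiberCoord
  split_ifs <;> fun_prop

theorem norm_fiberCoord_le {R : ℝ} (hX : X ∈ petalBase j₀ R) (j : Fin s) :
    ‖fiberCoord α j₀ c X j‖ ≤ 1 + ‖c‖ + ∑ i, (α i : ℝ) := by
  rw [mem_petalBase] at hX
  have hsum0 : 0 ≤ ∑ i, (α i : ℝ) := by positivity
  unfold fiberCoord
  split_ifs with hj
  · have hsum : ‖∑ i ∈ Finset.univ.erase j₀, (α i : ℂ) * X i‖ ≤ ∑ i, (α i : ℝ) :=
      calc ‖∑ i ∈ Finset.univ.erase j₀, (α i : ℂ) * X i‖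
          ≤ ∑ i ∈ Finset.univ.erase j₀, (α i : ℝ) := norm_sum_le_of_le _ fun i hi => by
            rw [norm_mul, Complex.norm_natCast]
            exact mul_le_of_le_one_right (α i).cast_nonneg (hX.2 i (Finset.ne_of_mem_erase hi)).le
        _ ≤ ∑ i, (α i : ℝ) := Finset.sum_le_sum_of_subset_of_nonneg (Finset.subset_univ _)
            fun i _ _ => (α i).cast_nonneg
    calc ‖(c - ∑ i ∈ Finset.univ.erase j₀, (α i : ℂ) * X i) / α j₀‖
        ≤ ‖c - ∑ i ∈ Finset.univ.erase j₀, (α i : ℂ) * X i‖ := by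
          rw [norm_div, Complex.norm_natCast]
          exact div_nat_le_self_of_nonnneg (norm_nonneg _) _
      _ ≤ ‖c‖ + ∑ i, (α i : ℝ) := (norm_sub_le _ _).trans (by gcongr)
      _ ≤ _ := by linarith
  · linarith [hX.2 j hj, norm_nonneg c]

end FiberCoord

/-- The logarithms of the coordinates of the petals over `X`: their resonant monomial is
`τ e^{Y (X j₀)}`, and the coordinates of `X` other than `j₀` parametrize the fibres of the
monomial. -/
noncomputable def petalExponent {s : ℕ} (α : Fin s → ℕ) (j₀ : Fin s) (τ : ℂ) (w : Fin s → ℂ → ℂ)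
    (X : Fin s → ℂ) (j : Fin s) : ℂ :=
  fiberCoord α j₀ (Complex.log τ) X j + w j (X j₀)

/-- The `i`-th petal; the petals differ by the roots of unity `ζ j`, and the normal form maps the
`i`-th one into the next. -/
noncomputable def petal {s : ℕ} (α : Fin s → ℕ) (j₀ : Fin s) (τ : ℂ) (w : Fin s → ℂ → ℂ)
    (ζ : Fin s → ℂ) (i : ℕ) (X : Fin s → ℂ) (j : Fin s) : ℂ :=
  ζ j ^ i * Complex.exp (petalExponent α j₀ τ w X j)

section Petal

variable {s : ℕ} {α : Fin s → ℕ} {j₀ : Fin s} {τ : ℂ} {w : Fin s → ℂ → ℂ} {ζ : Fin s → ℂ}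
  {X X' : Fin s → ℂ} {R : ℝ} {d i : ℕ}

theorem petalExponent_add_single (t : ℂ) (j : Fin s) :
    petalExponent α j₀ τ w (X + Pi.single j₀ t) j
      = fiberCoord α j₀ (Complex.log τ) X j + w j (X j₀ + t) := by
  rw [petalExponent, fiberCoord_add_single, Pi.add_apply, Pi.single_eq_same]

theorem norm_petal_apply (hζ : ∀ j, ‖ζ j‖ = 1) (j : Fin s) :
    ‖petal α j₀ τ w ζ i X j‖ = Real.exp (petalExponent α j₀ τ w X j).re := by
  rw [petal, norm_mul, norm_pow, hζ, one_pow, one_mul, Complex.norm_exp]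

theorem petal_apply_ne_zero (hζ : ∀ j, ‖ζ j‖ = 1) (j : Fin s) : petal α j₀ τ w ζ i X j ≠ 0 :=
  norm_pos_iff.1 (norm_petal_apply hζ j ▸ Real.exp_pos _)

theorem petal_eq_petal_zero (hζ : ∀ j, ζ j ^ d = 1) : petal α j₀ τ w ζ d = petal α j₀ τ w ζ 0 := by
  ext X j
  rw [petal, petal, hζ, pow_zero]

theorem contDiffAt_petalExponent (hw : ∀ j, DifferentiableOn ℂ (w j) (halfStrip R))
    (hX : X ∈ petalBase j₀ R) (j : Fin s) :
    ContDiffAt ℂ 1 (fun X => petalExponent α j₀ τ w X j) X := by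
  have hwX : ContDiffAt ℂ 1 (w j) (X j₀) := ((hw j).contDiffOn (isOpen_halfStrip R)).contDiffAt
    ((isOpen_halfStrip R).mem_nhds (mem_petalBase.1 hX).1)
  exact (contDiff_fiberCoord j).contDiffAt.add (hwX.comp X (contDiff_apply ℂ ℂ j₀).contDiffAt)

theorem contDiffAt_petal (hw : ∀ j, DifferentiableOn ℂ (w j) (halfStrip R))
    (hX : X ∈ petalBase j₀ R) : ContDiffAt ℂ 1 (petal α j₀ τ w ζ i) X :=
  contDiffAt_pi.2 fun j => contDiffAt_const.mul (contDiffAt_petalExponent hw hX j).cexp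

theorem fderiv_petalExponent_of_ne (hw : ∀ j, DifferentiableOn ℂ (w j) (halfStrip R))
    (hX : X ∈ petalBase j₀ R) {j : Fin s} (hj : j ≠ j₀) (v : Fin s → ℂ) :
    fderiv ℂ (fun X => petalExponent α j₀ τ w X j) X v = v j + deriv (w j) (X j₀) * v j₀ := by
  have hwX : HasFDerivAt (fun X : Fin s → ℂ => w j (X j₀))
      (deriv (w j) (X j₀) • (ContinuousLinearMap.proj j₀ : (Fin s → ℂ) →L[ℂ] ℂ)) X :=
    (((hw j).differentiableAt ((isOpen_halfStrip R).mem_nhds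
      (mem_petalBase.1 hX).1)).hasDerivAt).comp_hasFDerivAt X (hasFDerivAt_apply j₀ X)
  simp only [petalExponent, fiberCoord_of_ne hj]
  rw [((hasFDerivAt_apply j X).fun_add hwX).fderiv]
  rfl

theorem fderiv_petal_apply (hw : ∀ j, DifferentiableOn ℂ (w j) (halfStrip R))
    (hX : X ∈ petalBase j₀ R) (v : Fin s → ℂ) (j : Fin s) :
    fderiv ℂ (petal α j₀ τ w ζ i) X v j
      = petal α j₀ τ w ζ i X j * fderiv ℂ (fun X => petalExponent α j₀ τ w X j) X v := by
  have hexp := (((contDiffAt_petalExponent (α := α) (τ := τ) hw hX j).differentiableAt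
    one_ne_zero).hasFDerivAt.cexp).const_mul (ζ j ^ i)
  have hpetal := hasFDerivAt_pi'.1
    ((contDiffAt_petal (α := α) (τ := τ) (ζ := ζ) (i := i) hw hX).differentiableAt
      one_ne_zero).hasFDerivAt j
  have happly := DFunLike.congr_fun (hpetal.unique hexp) v
  rw [petal, mul_assoc]
  exact happly

theorem eq_of_exp_fiberCoord (hX : X ∈ petalBase j₀ R) (hX' : X' ∈ petalBase j₀ R)
    (h₀ : X j₀ = X' j₀) (hexp : ∀ j, Complex.exp (fiberCoord α j₀ (Complex.log τ) X j)
      = Complex.exp (fiberCoord α j₀ (Complex.log τ) X' j)) : X = X' := by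
  have him {X : Fin s → ℂ} (hX : X ∈ petalBase j₀ R) {j : Fin s} (hj : j ≠ j₀) :
      -Real.pi < (X j).im ∧ (X j).im ≤ Real.pi := by
    have := abs_lt.1 ((Complex.abs_im_le_norm _).trans_lt ((mem_petalBase.1 hX).2 j hj))
    constructor <;> linarith [Real.pi_gt_three]
  ext j
  rcases eq_or_ne j j₀ with rfl | hj
  · exact h₀
  · have hj' := hexp j
    rw [fiberCoord_of_ne hj, fiberCoord_of_ne hj] at hj'
    exact Complex.exp_inj_of_neg_pi_lt_of_le_pi (him hX hj).1 (him hX hj).2 (him hX' hj).1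
      (him hX' hj).2 hj'

theorem sum_mul_fiberCoord_of_eq_smul {β : Fin s → ℕ} {c : ℂ} (hα : α = d • β) (hd : d ≠ 0)
    (hj₀ : α j₀ ≠ 0) : ∑ j, β j * fiberCoord α j₀ c X j = c / d := by
  rw [eq_div_iff (Nat.cast_ne_zero.2 hd), Finset.sum_mul]
  refine Eq.trans (Finset.sum_congr rfl fun j _ => ?_) (sum_fiberCoord (X := X) hj₀)
  rw [congrFun hα j, Pi.smul_apply, smul_eq_mul, Nat.cast_mul]
  ring

theorem monomialPow_eq_of_eq_smul {lam : Fin s → ℂ} {β : Fin s → ℕ} {θ : Fin s → ℝ}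
    (hα : α = d • β) (hd : d ≠ 0) (hθ : ∑ j, (α j : ℂ) * θ j = 0)
    (hlam : ∀ j, lam j = ζ j * Complex.exp (Complex.I * θ j)) :
    monomialPow lam β = monomialPow ζ β := by
  have hsum : ∑ j, (β j : ℂ) * (Complex.I * θ j) = 0 := by
    apply mul_left_cancel₀ (Nat.cast_ne_zero.2 hd : (d : ℂ) ≠ 0)
    rw [mul_zero, ← mul_zero Complex.I, ← hθ, Finset.mul_sum, Finset.mul_sum]
    refine Finset.sum_congr rfl fun j _ => ?_
    rw [congrFun hα j, Pi.smul_apply, smul_eq_mul, Nat.cast_mul]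
    ring
  rw [funext hlam, monomialPow_mul, monomialPow_exp, hsum, Complex.exp_zero, mul_one]

variable {L : Fin s → ℂ → ℂ} {θ : Fin s → ℝ} {B : ℝ} {Y : ℂ → ℂ}

namespace IsPetalCoordinates

section

variable (hw : IsPetalCoordinates L (fun j => α j) θ τ R B w Y) (hX : X ∈ petalBase j₀ R)
include hw hX

theorem sum_petalExponent (hj₀ : α j₀ ≠ 0) :
    ∑ j, α j * petalExponent α j₀ τ w X j = Complex.log τ + Y (X j₀) := by
  simp only [petalExponent, mul_add, Finset.sum_add_distrib]
  rw [sum_fiberCoord hj₀, hw.sum_eq _ (mem_petalBase.1 hX).1]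

theorem monomialPow_petal (hj₀ : α j₀ ≠ 0) (hτ : τ ≠ 0) (hζ : monomialPow ζ α = 1) :
    monomialPow (petal α j₀ τ w ζ i X) α = τ * Complex.exp (Y (X j₀)) := by
  unfold petal
  rw [monomialPow_mul, monomialPow_pow, monomialPow_exp, hζ, one_pow, one_mul,
    hw.sum_petalExponent hX hj₀, Complex.exp_add, Complex.exp_log hτ]

theorem sum_fderiv_petalExponent (hj₀ : α j₀ ≠ 0) (v : Fin s → ℂ) :
    ∑ j, α j * fderiv ℂ (fun X => petalExponent α j₀ τ w X j) X v = deriv Y (X j₀) * v j₀ := by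
  have hsum : HasFDerivAt (fun X => ∑ j, (α j : ℂ) * petalExponent α j₀ τ w X j)
      (∑ j, (α j : ℂ) • fderiv ℂ (fun X => petalExponent α j₀ τ w X j) X) X :=
    HasFDerivAt.fun_sum fun j _ => ((contDiffAt_petalExponent hw.differentiableOn hX
      j).differentiableAt one_ne_zero).hasFDerivAt.const_mul _
  have hY : HasFDerivAt (fun X : Fin s → ℂ => Complex.log τ + Y (X j₀))
      (deriv Y (X j₀) • (ContinuousLinearMap.proj j₀ : (Fin s → ℂ) →L[ℂ] ℂ)) X :=
    (((differentiableAt_of_deriv_ne_zero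
      (hw.deriv_ne_zero _ (mem_petalBase.1 hX).1)).hasDerivAt).comp_hasFDerivAt X
        (hasFDerivAt_apply j₀ X)).const_add _
  have heq : (fun X => ∑ j, (α j : ℂ) * petalExponent α j₀ τ w X j)
      =ᶠ[𝓝 X] fun X => Complex.log τ + Y (X j₀) := by
    filter_upwards [isOpen_petalBase.mem_nhds hX] with X' hX' using hw.sum_petalExponent hX' hj₀
  have happly := DFunLike.congr_fun (hsum.unique (hY.congr_of_eventuallyEq heq)) v
  rw [sum_apply] at happly
  exact happly

theorem injective_fderiv_petal (hj₀ : α j₀ ≠ 0) (hζ : ∀ j, ‖ζ j‖ = 1) :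
    Function.Injective (fderiv ℂ (petal α j₀ τ w ζ i) X) := by
  refine (injective_iff_map_eq_zero _).2 fun v hv => ?_
  have hexp (j : Fin s) : fderiv ℂ (fun X => petalExponent α j₀ τ w X j) X v = 0 := by
    have hvj := congrFun hv j
    rw [fderiv_petal_apply hw.differentiableOn hX] at hvj
    exact (mul_eq_zero.1 hvj).resolve_left (petal_apply_ne_zero hζ j)
  have hv₀ : v j₀ = 0 := by
    have hsum := hw.sum_fderiv_petalExponent hX hj₀ v
    simp only [hexp, mul_zero, Finset.sum_const_zero] at hsum
    exact (mul_eq_zero.1 hsum.symm).resolve_left (hw.deriv_ne_zero _ (mem_petalBase.1 hX).1)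
  ext j
  rcases eq_or_ne j j₀ with rfl | hj
  · exact hv₀
  · have hj' := hexp j
    rwa [fderiv_petalExponent_of_ne hw.differentiableOn hX hj, hv₀, mul_zero, add_zero] at hj'

theorem norm_petal_le (hζ : ∀ j, ‖ζ j‖ = 1) :
    ‖petal α j₀ τ w ζ i X‖
      ≤ Real.exp (1 + ‖Complex.log τ‖ + ∑ j, (α j : ℝ) + B) := by
  refine (pi_norm_le_iff_of_nonneg (Real.exp_nonneg _)).2 fun j => ?_
  rw [norm_petal_apply hζ, petalExponent, Complex.add_re]
  exact Real.exp_le_exp.2 (add_le_add ((Complex.re_le_norm _).trans (norm_fiberCoord_le hX j))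
    (hw.re_le _ (mem_petalBase.1 hX).1 j))

theorem petal_succ {lam : Fin s → ℂ} (hj₀ : α j₀ ≠ 0) (hτ : τ ≠ 0) (hζ : monomialPow ζ α = 1)
    (hlam : ∀ j, lam j = ζ j * Complex.exp (Complex.I * θ j)) (j : Fin s) :
    petal α j₀ τ w ζ (i + 1) (X + Pi.single j₀ 1) j = lam j * petal α j₀ τ w ζ i X j
      * Complex.exp (L j (monomialPow (petal α j₀ τ w ζ i X) α)) := by
  rw [hw.monomialPow_petal hX hj₀ hτ hζ, petal, petal, petalExponent_add_single, petalExponent,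
    hw.add_one _ (mem_petalBase.1 hX).1, hlam, pow_succ]
  simp only [Complex.exp_add]
  ring

theorem tendsto_petal (hζ : ∀ j, ‖ζ j‖ = 1) :
    Tendsto (fun l : ℕ => petal α j₀ τ w ζ (i + l) (X + Pi.single j₀ (l : ℂ))) atTop (𝓝 0) := by
  refine tendsto_pi_nhds.2 fun j => tendsto_zero_iff_norm_tendsto_zero.2 ?_
  simp only [norm_petal_apply hζ, petalExponent_add_single, Complex.add_re]
  exact Real.tendsto_exp_atBot.comp
    (tendsto_const_nhds.add_atBot (hw.tendsto_re _ (mem_petalBase.1 hX).1 j))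

end

theorem petal_injective (hw : IsPetalCoordinates L (fun j => α j) θ τ R B w Y) {β : Fin s → ℕ}
    (hj₀ : α j₀ ≠ 0) (hτ : τ ≠ 0) (hζ : ∀ j, ζ j ^ d = 1) (hα : α = d • β) (hd : d ≠ 0)
    (hβ : IsPrimitiveRoot (monomialPow ζ β) d) {i' : ℕ} (hi : i < d) (hi' : i' < d)
    (hX : X ∈ petalBase j₀ R) (hX' : X' ∈ petalBase j₀ R)
    (h : petal α j₀ τ w ζ i X = petal α j₀ τ w ζ i' X') : i = i' ∧ X = X' := by
  have hζα : monomialPow ζ α = 1 := by rw [hα, monomialPow_smul, hβ.pow_eq_one]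
  have h₀ : X j₀ = X' j₀ := by
    refine hw.injOn_exp (mem_petalBase.1 hX).1 (mem_petalBase.1 hX').1 (mul_left_cancel₀ hτ ?_)
    simpa only [hw.monomialPow_petal hX hj₀ hτ hζα, hw.monomialPow_petal hX' hj₀ hτ hζα]
      using congrArg (fun z => monomialPow z α) h
  have hfiber (j : Fin s) : ζ j ^ i * Complex.exp (fiberCoord α j₀ (Complex.log τ) X j)
      = ζ j ^ i' * Complex.exp (fiberCoord α j₀ (Complex.log τ) X' j) := by
    have hj := congrFun h j
    simp only [petal, petalExponent, h₀, Complex.exp_add, ← mul_assoc] at hj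
    exact mul_right_cancel₀ (Complex.exp_ne_zero _) hj
  have hii' : i = i' := by
    have hβi := congrArg (fun z => monomialPow z β) (funext hfiber)
    simp only [monomialPow_mul, monomialPow_pow, monomialPow_exp,
      sum_mul_fiberCoord_of_eq_smul hα hd hj₀] at hβi
    exact hβ.pow_inj hi hi' (mul_right_cancel₀ (Complex.exp_ne_zero _) hβi)
  subst hii'
  have hζ0 (j : Fin s) : ζ j ≠ 0 := (IsUnit.of_pow_eq_one (hζ j) hd).ne_zero
  exact ⟨rfl, eq_of_exp_fiberCoord hX hX' h₀ fun j =>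
    mul_left_cancel₀ (pow_ne_zero i (hζ0 j)) (hfiber j)⟩

end IsPetalCoordinates

end Petal

/-- The maps `Z i`, `i < d`, are holomorphic embeddings of the base into the punctured ball of
radius `r`, with pairwise disjoint images. The normal form `z ↦ λ_j z_j e^{L_j (z^α)}` maps
`Z i X` to `Z (i + 1) (X + e_{j₀})`, the index `i` being read modulo `d`, and its iterates tend
to `0` on all the images. -/
structure IsPetalFamily {s : ℕ} (lam : Fin s → ℂ) (α : Fin s → ℕ) (L : Fin s → ℂ → ℂ)
    (j₀ : Fin s) (R r : ℝ) (d : ℕ) (Z : ℕ → (Fin s → ℂ) → Fin s → ℂ) : Prop where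
  contDiffAt : ∀ i, ∀ X ∈ petalBase j₀ R, ContDiffAt ℂ 1 (Z i) X
  injective_fderiv : ∀ i, ∀ X ∈ petalBase j₀ R, Function.Injective (fderiv ℂ (Z i) X)
  ne_zero : ∀ i, ∀ X ∈ petalBase j₀ R, Z i X ≠ 0
  norm_lt : ∀ i, ∀ X ∈ petalBase j₀ R, ‖Z i X‖ < r
  injective : ∀ i < d, ∀ i' < d, ∀ X ∈ petalBase j₀ R, ∀ X' ∈ petalBase j₀ R,
    Z i X = Z i' X' → i = i' ∧ X = X'
  step : ∀ i, ∀ X ∈ petalBase j₀ R, ∀ j, Z (i + 1) (X + Pi.single j₀ 1) j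
    = lam j * Z i X j * Complex.exp (L j (monomialPow (Z i X) α))
  periodic : Z d = Z 0
  tendsto : ∀ i, ∀ X ∈ petalBase j₀ R,
    Tendsto (fun l : ℕ => Z (i + l) (X + Pi.single j₀ (l : ℂ))) atTop (𝓝 0)

theorem exists_isPetalFamily {s : ℕ} {lam : Fin s → ℂ} {α β : Fin s → ℕ} {A : Fin s → ℂ}
    {L : Fin s → ℂ → ℂ} {k : ℕ} {Λ : ℂ} {j₀ : Fin s} {r : ℝ}
    (hL : ∀ j, HasLeadingTerm (L j) (A j) k) (hk : k ≠ 0) (hmod : ∀ j, ‖lam j‖ = 1)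
    (hα : α = Finset.univ.gcd α • β)
    (hβ : IsPrimitiveRoot (monomialPow lam β) (Finset.univ.gcd α))
    (hΛ : ∑ j, α j * A j = Λ) (hΛ0 : Λ ≠ 0) (hA : ∀ j, 0 < (A j / Λ).re) (hj₀ : α j₀ ≠ 0)
    (hr : 0 < r) : ∃ R Z, IsPetalFamily lam α L j₀ R r (Finset.univ.gcd α) Z := by
  have hα0 : α ≠ 0 := fun h => hj₀ (congrFun h j₀)
  have hd : Finset.univ.gcd α ≠ 0 := fun h =>
    hj₀ (Finset.gcd_eq_zero_iff.1 h j₀ (Finset.mem_univ j₀))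
  have hlam : monomialPow lam α = 1 := by rw [hα, monomialPow_smul, hβ.pow_eq_one]
  obtain ⟨τ, hτ⟩ := IsAlgClosed.exists_pow_nat_eq (-1 / (k * Λ)) (Nat.pos_of_ne_zero hk)
  replace hτ : k * Λ * τ ^ k = -1 := by
    rw [hτ, mul_div_cancel₀ _ (mul_ne_zero (Nat.cast_ne_zero.2 hk) hΛ0)]
  have hτ0 : τ ≠ 0 := by
    rintro rfl
    rw [zero_pow hk, mul_zero, zero_eq_neg] at hτ
    exact one_ne_zero hτ
  obtain ⟨θ, ζ, hθ, hlamζ, hζ⟩ := exists_roots_of_unity hα0 hmod hlam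
  have hζ1 (j : Fin s) : ‖ζ j‖ = 1 := Complex.norm_eq_one_of_pow_eq_one (hζ j) hd
  rw [monomialPow_eq_of_eq_smul hα hd hθ hlamζ] at hβ
  have hζα : monomialPow ζ α = 1 := by rw [hα, monomialPow_smul, hβ.pow_eq_one]
  obtain ⟨R, w, Y, hw⟩ := exists_isPetalCoordinates hL hk hΛ hΛ0 hA hτ hθ
    (Real.log (r / 2) - (1 + ‖Complex.log τ‖ + ∑ j, (α j : ℝ)))
  refine ⟨R, petal α j₀ τ w ζ,
    { contDiffAt := fun _ _ hX => contDiffAt_petal hw.differentiableOn hX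
      injective_fderiv := fun _ _ hX => hw.injective_fderiv_petal hX hj₀ hζ1
      ne_zero := fun _ _ _ h => petal_apply_ne_zero hζ1 j₀ (congrFun h j₀)
      norm_lt := fun _ _ hX => (hw.norm_petal_le hX hζ1).trans_lt ?_
      injective := fun _ hi _ hi' _ hX _ hX' =>
        hw.petal_injective hj₀ hτ0 hζ hα hd hβ hi hi' hX hX'
      step := fun _ _ hX => hw.petal_succ hX hj₀ hτ0 hζα hlamζ
      periodic := petal_eq_petal_zero hζ
      tendsto := fun _ _ hX => hw.tendsto_petal hX hζ1 }⟩
  rw [add_sub_cancel, Real.exp_log (half_pos hr)]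
  exact half_lt_self hr

/-! ### Gluing the petals -/

theorem isOpenEmbedding_domRestrict_of_contDiffAt {𝕜 E F : Type*} [RCLike 𝕜]
    [NormedAddCommGroup E] [NormedSpace 𝕜 E] [CompleteSpace E] [NormedAddCommGroup F]
    [NormedSpace 𝕜 F] [CompleteSpace F] {f : E → F} {U : Set E} (hU : IsOpen U)
    (hf : ∀ x ∈ U, ContDiffAt 𝕜 1 f x) (hf' : ∀ x ∈ U, Function.Surjective (fderiv 𝕜 f x))
    (hinj : InjOn f U) : IsOpenEmbedding (U.domRestrict f) := by
  refine IsOpenEmbedding.of_continuous_injective_isOpenMap ?_ (injOn_iff_injective.1 hinj) ?_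
  · exact continuousOn_iff_continuous_domRestrict.1 fun x hx =>
      (hf x hx).continuousAt.continuousWithinAt
  · refine isOpenMap_iff_nhds_le.2 fun x => ?_
    have hmap := ((hf x x.2).hasStrictFDerivAt one_ne_zero).map_nhds_eq_of_surj
      (LinearMap.range_eq_top.2 (hf' x x.2))
    rw [← map_nhds_subtype_coe_eq_nhds x.2 (hU.mem_nhds x.2), Filter.map_map] at hmap
    exact hmap.ge

theorem isBiholomorphicImage_of_comp_eqOn {s n : ℕ} {D : Set (Fin s → ℂ)}
    {W : Set (Fin n → ℂ)} {φ : (Fin s → ℂ) → Fin n → ℂ} {Ψ : (Fin n → ℂ) → Fin s → ℂ}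
    {f : (Fin s → ℂ) → Fin s → ℂ} (hD : IsOpen D) (hW : IsOpen W) (hφ : DifferentiableOn ℂ φ D)
    (hφW : MapsTo φ D W) (hΨ : DifferentiableOn ℂ Ψ W) (hΨφ : EqOn (Ψ ∘ φ) f D)
    (hf : ∀ x ∈ D, ContDiffAt ℂ 1 f x) (hf' : ∀ x ∈ D, Function.Injective (fderiv ℂ f x))
    (hinj : InjOn f D) : IsBiholomorphicImage D (φ '' D) := by
  refine ⟨φ, hφ, fun x hx => ?_, ?_, rfl⟩
  · have hcomp := ((hΨ.differentiableAt (hW.mem_nhds (hφW hx))).hasFDerivAt.comp x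
      (hφ.differentiableAt (hD.mem_nhds hx)).hasFDerivAt).congr_of_eventuallyEq
      (hΨφ.symm.eventuallyEq_of_mem (hD.mem_nhds hx))
    have hinj' := hf' x hx
    rw [hcomp.fderiv, ContinuousLinearMap.coe_comp] at hinj'
    exact hinj'.of_comp
  · have hemb : IsEmbedding (D.domRestrict f) := (isOpenEmbedding_domRestrict_of_contDiffAt hD hf
      (fun x hx => LinearMap.injective_iff_surjective.1 (hf' x hx)) hinj).isEmbedding
    have hfactor : D.domRestrict f = W.domRestrict Ψ ∘ hφW.restrict φ D W :=
      funext fun x => (hΨφ x.2).symm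
    rw [hfactor] at hemb
    exact IsEmbedding.subtypeVal.comp (IsEmbedding.of_comp (hφ.continuousOn.mapsToRestrict hφW)
      (continuousOn_iff_continuous_domRestrict.1 hΨ.continuousOn) hemb)

theorem exists_eqOn_of_pairwise_disjoint {ι X Y : Type*} [Nonempty Y] {D : ι → Set X}
    (hD : Pairwise fun i j => Disjoint (D i) (D j)) (g : ι → X → Y) :
    ∃ f : X → Y, ∀ i, EqOn f (g i) (D i) := by
  classical
  refine ⟨fun x => if h : ∃ i, x ∈ D i then g h.choose x else Classical.arbitrary Y,
    fun i x hx => ?_⟩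
  have hex : ∃ i, x ∈ D i := ⟨i, hx⟩
  have hchoose : hex.choose = i :=
    by_contra fun hne => disjoint_left.1 (hD hne) hex.choose_spec hx
  simp only [dif_pos hex, hchoose]

/-- Disjoint translates of the base, on which the petals are parametrized simultaneously. -/
def petalCopy {s : ℕ} (j₀ : Fin s) (R : ℝ) (i : ℕ) : Set (Fin s → ℂ) :=
  (fun X => X - Pi.single j₀ (4 * i * Complex.I)) ⁻¹' petalBase j₀ R

section PetalCopy

variable {s : ℕ} {j₀ : Fin s} {R : ℝ}

theorem isOpen_petalCopy (i : ℕ) : IsOpen (petalCopy j₀ R i) :=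
  isOpen_petalBase.preimage (continuous_id.sub continuous_const)

theorem add_single_mem_petalCopy {X : Fin s → ℂ} (hX : X ∈ petalBase j₀ R) (i : ℕ) :
    X + Pi.single j₀ (4 * i * Complex.I) ∈ petalCopy j₀ R i := by
  rwa [petalCopy, mem_preimage, add_sub_cancel_right]

theorem isSimplyConnected_petalCopy (i : ℕ) : IsSimplyConnected (petalCopy j₀ R i) := by
  have hconvex : Convex ℝ (petalCopy j₀ R i) := by
    simpa only [petalCopy, sub_eq_add_neg] using convex_petalBase.translate_preimage_left _
  obtain ⟨X, hX⟩ := petalBase_nonempty (j₀ := j₀) (R := R)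
  have := hconvex.contractibleSpace ⟨_, add_single_mem_petalCopy hX i⟩
  exact SimplyConnectedSpace.ofContractible _

theorem disjoint_petalCopy {i i' : ℕ} (h : i ≠ i') :
    Disjoint (petalCopy j₀ R i) (petalCopy j₀ R i') := by
  refine disjoint_left.2 fun X hX hX' => h ?_
  have him {i : ℕ} (hX : X ∈ petalCopy j₀ R i) : |(X j₀).im - 4 * i| < 1 := by
    simpa using (mem_petalBase.1 hX).1.2
  have hlt {i i' : ℕ} (hX : X ∈ petalCopy j₀ R i) (hX' : X ∈ petalCopy j₀ R i') : i < i' + 1 := by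
    have hcast : (i : ℝ) < i' + 1 := by linarith [(abs_lt.1 (him hX)).1, (abs_lt.1 (him hX')).2]
    exact_mod_cast hcast
  exact le_antisymm (Nat.lt_succ_iff.1 (hlt hX hX')) (Nat.lt_succ_iff.1 (hlt hX' hX))

end PetalCopy

section ParabolicSet

variable {s n d : ℕ} {j₀ : Fin s} {R r : ℝ} {Z : ℕ → (Fin s → ℂ) → Fin s → ℂ}
  {lam : Fin n → ℂ} {α : Fin n → ℕ} {L : Fin n → ℂ → ℂ}
  {G Φ : OpenPartialHomeomorph (Fin n → ℂ) (Fin n → ℂ)} {X : Fin s → ℂ} {hs : s ≤ n}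

theorem IsPetalFamily.firstCoords_mem_ball {lam : Fin s → ℂ} {α : Fin s → ℕ}
    {L : Fin s → ℂ → ℂ} (hZ : IsPetalFamily lam α L j₀ R r d Z) (hX : X ∈ petalBase j₀ R)
    (i : ℕ) : (firstCoords (Z i X) : Fin n → ℂ) ∈ Metric.ball 0 r :=
  mem_ball_zero_iff.2 (norm_firstCoords_lt (hZ.norm_lt i X hX))

theorem IsPetalFamily.exists_glued {lam : Fin s → ℂ} {α : Fin s → ℕ} {L : Fin s → ℂ → ℂ}
    (hZ : IsPetalFamily lam α L j₀ R r d Z) :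
    ∃ f : (Fin s → ℂ) → Fin s → ℂ,
      (∀ i : Fin d, ∀ X ∈ petalCopy j₀ R i, f X = Z i (X - Pi.single j₀ (4 * i * Complex.I))) ∧
      (∀ X ∈ ⋃ i : Fin d, petalCopy j₀ R i, ContDiffAt ℂ 1 f X) ∧
      (∀ X ∈ ⋃ i : Fin d, petalCopy j₀ R i, Function.Injective (fderiv ℂ f X)) ∧
      InjOn f (⋃ i : Fin d, petalCopy j₀ R i) := by
  obtain ⟨f, hf⟩ := exists_eqOn_of_pairwise_disjoint (D := fun i : Fin d => petalCopy j₀ R i)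
    (fun i i' h => disjoint_petalCopy (Fin.val_ne_of_ne h))
    fun i X => Z i (X - Pi.single j₀ (4 * i * Complex.I))
  have heq (i : Fin d) {X : Fin s → ℂ} (hX : X ∈ petalCopy j₀ R i) :
      f =ᶠ[𝓝 X] fun X => Z i (X - Pi.single j₀ (4 * i * Complex.I)) :=
    (hf i).eventuallyEq_of_mem ((isOpen_petalCopy i).mem_nhds hX)
  refine ⟨f, hf, fun X hX => ?_, fun X hX => ?_, fun X hX X' hX' h => ?_⟩
  · obtain ⟨i, hi⟩ := mem_iUnion.1 hX
    exact ((hZ.contDiffAt i _ hi).comp X (contDiffAt_id.sub contDiffAt_const)).congr_of_eventuallyEq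
      (heq i hi)
  · obtain ⟨i, hi⟩ := mem_iUnion.1 hX
    rw [(heq i hi).fderiv_eq, fderiv_comp_sub]
    exact hZ.injective_fderiv i _ hi
  · obtain ⟨i, hi⟩ := mem_iUnion.1 hX
    obtain ⟨i', hi'⟩ := mem_iUnion.1 hX'
    rw [hf i hi, hf i' hi'] at h
    obtain ⟨hii', hXX'⟩ := hZ.injective i i.2 i' i'.2 _ hi _ hi' h
    rw [hii'] at hXX'
    exact sub_left_injective hXX'

/-- The union of the `d` petals of the family `Z`, transported to the domain of `G` by the
chart `Φ`. -/
def parabolicSet (Φ : OpenPartialHomeomorph (Fin n → ℂ) (Fin n → ℂ)) (j₀ : Fin s) (R : ℝ) (d : ℕ)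
    (Z : ℕ → (Fin s → ℂ) → Fin s → ℂ) : Set (Fin n → ℂ) :=
  {p | ∃ i < d, ∃ X ∈ petalBase j₀ R, Φ.symm (firstCoords (Z i X)) = p}

namespace IsNormalChart

theorem map_symm_firstCoords (hchart : IsNormalChart G Φ lam α L r)
    (hα : ∀ j : Fin n, s ≤ (j : ℕ) → α j = 0) {x y : Fin s → ℂ} (hx : ‖x‖ < r)
    (hy : ∀ j, y j = lam (Fin.castLE hs j) * x j
      * Complex.exp (L (Fin.castLE hs j) (monomialPow x fun j => α (Fin.castLE hs j)))) :
    G (Φ.symm (firstCoords x)) = Φ.symm (firstCoords y) := by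
  have hball := mem_ball_zero_iff.2 (norm_firstCoords_lt (n := n) hx)
  have hmono : monomialPow (firstCoords x) α = monomialPow x fun j => α (Fin.castLE hs j) := by
    rw [monomialPow_eq_castLE hs hα]
    simp only [firstCoords_castLE]
  rw [← Φ.left_inv (hchart.map_mem_source _ hball)]
  congr 1
  ext j
  rw [hchart.conj _ hball j, hmono]
  rcases lt_or_ge (j : ℕ) s with hj | hj
  · obtain ⟨j, rfl⟩ : ∃ j', Fin.castLE hs j' = j := ⟨⟨j, hj⟩, rfl⟩
    rw [firstCoords_castLE, firstCoords_castLE, hy]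
  · rw [firstCoords, firstCoords, dif_neg hj.not_gt, dif_neg hj.not_gt, mul_zero, zero_mul]

variable (hchart : IsNormalChart G Φ lam α L r)
  (hZ : IsPetalFamily (fun j => lam (Fin.castLE hs j)) (fun j => α (Fin.castLE hs j))
    (fun j => L (Fin.castLE hs j)) j₀ R r d Z)
include hchart hZ

theorem map_petal (hα : ∀ j : Fin n, s ≤ (j : ℕ) → α j = 0) (hX : X ∈ petalBase j₀ R) (i : ℕ) :
    G (Φ.symm (firstCoords (Z i X)))
      = Φ.symm (firstCoords (Z (i + 1) (X + Pi.single j₀ 1))) :=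
  hchart.map_symm_firstCoords hα (hZ.norm_lt i X hX) (hZ.step i X hX)

theorem iterate_petal (hα : ∀ j : Fin n, s ≤ (j : ℕ) → α j = 0) (hX : X ∈ petalBase j₀ R)
    (i l : ℕ) : G^[l] (Φ.symm (firstCoords (Z i X)))
      = Φ.symm (firstCoords (Z (i + l) (X + Pi.single j₀ (l : ℂ)))) := by
  induction l with
  | zero => rw [Nat.cast_zero, Pi.single_zero, add_zero, add_zero, Function.iterate_zero_apply]
  | succ l ih =>
    rw [Function.iterate_succ_apply', ih,
      hchart.map_petal hZ hα (add_single_natCast_mem_petalBase hX l), add_assoc X,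
      ← Pi.single_add, ← Nat.cast_succ, add_assoc]

theorem tendsto_iterate_petal (hΦ : IsBiholomorphicGerm Φ)
    (hα : ∀ j : Fin n, s ≤ (j : ℕ) → α j = 0) (hX : X ∈ petalBase j₀ R) (i : ℕ) :
    Tendsto (fun l : ℕ => G^[l] (Φ.symm (firstCoords (Z i X)))) atTop (𝓝 0) := by
  simp only [hchart.iterate_petal hZ hα hX]
  have hcoords : Tendsto (firstCoords : (Fin s → ℂ) → Fin n → ℂ) (𝓝 0) (𝓝 0) := by
    simpa only [firstCoords_zero]
      using (contDiff_firstCoords (s := s) (n := n)).continuous.tendsto 0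
  exact hΦ.tendsto_symm_zero.comp (hcoords.comp (hZ.tendsto i X hX))

theorem mapsTo_parabolicSet (hα : ∀ j : Fin n, s ≤ (j : ℕ) → α j = 0) :
    MapsTo G (parabolicSet Φ j₀ R d Z) (parabolicSet Φ j₀ R d Z) := by
  rintro _ ⟨i, hi, X, hX, rfl⟩
  have hX1 : X + Pi.single j₀ 1 ∈ petalBase j₀ R := by
    exact_mod_cast add_single_natCast_mem_petalBase hX 1
  rw [hchart.map_petal hZ hα hX]
  rcases (Nat.succ_le_of_lt hi).lt_or_eq with hlt | heq
  · exact ⟨i + 1, hlt, _, hX1, rfl⟩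
  · exact ⟨0, i.zero_le.trans_lt hi, _, hX1, by rw [← hZ.periodic, ← heq]⟩

theorem zero_notMem_parabolicSet (hΦ : IsBiholomorphicGerm Φ) : 0 ∉ parabolicSet Φ j₀ R d Z := by
  rintro ⟨i, -, X, hX, h⟩
  have hzero := Φ.symm.injOn (hchart.mem_target _ (hZ.firstCoords_mem_ball hX i))
    hΦ.zero_mem_target (h.trans hΦ.symm_zero.symm)
  refine hZ.ne_zero i X hX (funext fun j => ?_)
  rw [← firstCoords_castLE hs (Z i X) j, hzero]
  rfl

theorem isBiholomorphicImage_parabolicSet (hΦ : IsBiholomorphicGerm Φ) :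
    IsBiholomorphicImage (⋃ i : Fin d, petalCopy j₀ R i) (parabolicSet Φ j₀ R d Z) := by
  obtain ⟨f, hfZ, hf, hf', hinj⟩ := hZ.exists_glued
  have himage : (fun X => Φ.symm (firstCoords (f X))) '' (⋃ i : Fin d, petalCopy j₀ R i)
      = parabolicSet Φ j₀ R d Z := by
    ext p
    constructor
    · rintro ⟨X, hX, rfl⟩
      obtain ⟨i, hi⟩ := mem_iUnion.1 hX
      exact ⟨i, i.2, _, hi, congrArg (Φ.symm ∘ firstCoords) (hfZ i X hi).symm⟩
    · rintro ⟨i, hi, X, hX, rfl⟩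
      have hX' := add_single_mem_petalCopy hX i
      exact ⟨_, mem_iUnion.2 ⟨⟨i, hi⟩, hX'⟩, by simp only [hfZ ⟨i, hi⟩ _ hX', add_sub_cancel_right]⟩
  have htarget : MapsTo (fun X => (firstCoords (f X) : Fin n → ℂ))
      (⋃ i : Fin d, petalCopy j₀ R i) Φ.target := fun X hX => by
    obtain ⟨i, hi⟩ := mem_iUnion.1 hX
    simp only [hfZ i X hi]
    exact hchart.mem_target _ (hZ.firstCoords_mem_ball hi i)
  rw [← himage]
  refine isBiholomorphicImage_of_comp_eqOn (isOpen_iUnion fun i : Fin d => isOpen_petalCopy i)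
    Φ.open_source (Ψ := fun z j => Φ z (Fin.castLE hs j)) ?_
    (fun X hX => Φ.map_target (htarget hX)) ?_ (fun X hX => ?_) hf hf' hinj
  · exact hΦ.differentiableOn_symm.comp (fun X hX => ((contDiff_firstCoords.contDiffAt.comp X
      (hf X hX)).differentiableAt one_ne_zero).differentiableWithinAt) htarget
  · exact differentiableOn_pi.2 fun j => differentiableOn_pi.1 hΦ.differentiableOn _
  · ext j
    simp only [Function.comp_apply, Φ.right_inv (htarget hX), firstCoords_castLE]

theorem isParabolicManifold_parabolicSet (hΦ : IsBiholomorphicGerm Φ)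
    (hα : ∀ j : Fin n, s ≤ (j : ℕ) → α j = 0) (hd : 0 < d) :
    IsParabolicManifold G s d (parabolicSet Φ j₀ R d Z) where
  image := ⟨fun i => petalCopy j₀ R i, fun i => isOpen_petalCopy i,
    fun i => isSimplyConnected_petalCopy i,
    fun _ _ h => disjoint_petalCopy (Fin.val_ne_of_ne h),
    hchart.isBiholomorphicImage_parabolicSet hZ hΦ⟩
  zero_mem_closure := by
    obtain ⟨X, hX⟩ := petalBase_nonempty (j₀ := j₀) (R := R)
    exact mem_closure_of_tendsto (hchart.tendsto_iterate_petal hZ hΦ hα hX 0) <|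
      .of_forall fun l => (hchart.mapsTo_parabolicSet hZ hα).iterate l ⟨0, hd, X, hX, rfl⟩
  zero_notMem := hchart.zero_notMem_parabolicSet hZ hΦ
  subset_source := by
    rintro _ ⟨i, -, X, hX, rfl⟩
    exact hchart.mem_source _ (hZ.firstCoords_mem_ball hX i)
  mapsTo := hchart.mapsTo_parabolicSet hZ hα
  orbits := by
    rintro _ ⟨i, -, X, hX, rfl⟩
    exact hchart.tendsto_iterate_petal hZ hΦ hα hX i

end IsNormalChart

end ParabolicSet

theorem IsNormalChart.exists_isParabolicManifold {s n : ℕ}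
    {G Φ : OpenPartialHomeomorph (Fin n → ℂ) (Fin n → ℂ)} {lam A : Fin n → ℂ} {α : Fin n → ℕ}
    {L : Fin n → ℂ → ℂ} {k : ℕ} {r : ℝ} {Λ : ℂ} (hchart : IsNormalChart G Φ lam α L r)
    (hres : IsOneResonant G lam α) (hΦ : IsBiholomorphicGerm Φ)
    (hL : ∀ j, HasLeadingTerm (L j) (A j) k) (hk : k ≠ 0) (hmod : ∀ j, ‖lam j‖ = 1)
    (hΛ : ∑ j, α j * A j = Λ) (hΛ0 : Λ ≠ 0) (hs : s ≤ n)
    (hA : ∀ j : Fin n, (j : ℕ) < s → 0 < (A j / Λ).re)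
    (hα : ∀ j : Fin n, s ≤ (j : ℕ) → α j = 0) :
    ∃ P : Set (Fin n → ℂ), IsParabolicManifold G s (Finset.univ.gcd α) P := by
  obtain ⟨j₁, hj₁⟩ := Function.ne_iff.1 hres.generator_ne_zero
  have hj₁s : (j₁ : ℕ) < s := lt_of_not_ge fun h => hj₁ (hα j₁ h)
  have hd : 0 < Finset.univ.gcd α := Nat.pos_of_ne_zero fun h =>
    hj₁ (Finset.gcd_eq_zero_iff.1 h j₁ (Finset.mem_univ j₁))
  obtain ⟨β, hβ, -⟩ := Finset.extract_gcd α ⟨j₁, Finset.mem_univ j₁⟩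
  replace hβ : α = Finset.univ.gcd α • β := funext fun j => hβ j (Finset.mem_univ j)
  have hβs (j : Fin n) (hj : s ≤ (j : ℕ)) : β j = 0 := by
    have hαj := hα j hj
    rw [hβ, Pi.smul_apply, smul_eq_mul] at hαj
    exact (mul_eq_zero.1 hαj).resolve_left hd.ne'
  have hroot := hres.isPrimitiveRoot (fun j => norm_ne_zero_iff.1 (hmod j ▸ one_ne_zero)) hβ
  have hgcd := gcd_eq_castLE hs hα
  rw [hgcd, monomialPow_eq_castLE hs hβs] at hroot
  obtain ⟨R, Z, hZ⟩ := exists_isPetalFamily (fun j => hL (Fin.castLE hs j)) hk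
    (fun j => hmod (Fin.castLE hs j)) (hgcd ▸ funext fun j => congrFun hβ (Fin.castLE hs j)) hroot
    ((sum_eq_sum_castLE hs fun j hj => by rw [hα j hj, Nat.cast_zero, zero_mul]).symm.trans hΛ)
    hΛ0 (fun j => hA (Fin.castLE hs j) j.2) (j₀ := ⟨j₁, hj₁s⟩) hj₁ hchart.r_pos
  rw [hgcd] at hd ⊢
  exact ⟨_, hchart.isParabolicManifold_parabolicSet hZ hΦ hα hd⟩

theorem mainTheorem3_general {n : ℕ} (G : OpenPartialHomeomorph (Fin n → ℂ) (Fin n → ℂ))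
    (hG : IsBiholomorphicGerm G)
    (lam : Fin n → ℂ) (α : Fin n → ℕ) (hres : IsOneResonant G lam α)
    (hmod : ∀ j, ‖lam j‖ = 1)
    (a : Fin n → ℕ → ℂ) (hnf : HasHolomorphicNormalForm G lam α a)
    (k₀ : ℕ) (hk₀ : IsWeightedOrder a k₀)
    (hnondeg : resonantLambda lam α a k₀ ≠ 0)
    (s : ℕ) (hsn : s ≤ n)
    (hpos : ∀ j : Fin n, (j : ℕ) < s →
      0 < (a j k₀ / lam j * (1 / resonantLambda lam α a k₀)).re)
    (hneg : ∀ j : Fin n, s ≤ (j : ℕ) →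
      (a j k₀ / lam j * (1 / resonantLambda lam α a k₀)).re < 0) :
    (¬ (∀ j : Fin n, s ≤ (j : ℕ) → α j = 0) →
      ∀ w : Fin n → ℂ, OrbitConvergesToOrigin G w ↔ w = 0) ∧
    ((∀ j : Fin n, s ≤ (j : ℕ) → α j = 0) →
      ∃ P : Set (Fin n → ℂ), IsParabolicManifold G s (Finset.univ.gcd α) P) := by
  have hlam0 (j : Fin n) : lam j ≠ 0 := norm_ne_zero_iff.1 (hmod j ▸ one_ne_zero)
  have hk₀0 : k₀ ≠ 0 := Nat.one_le_iff_ne_zero.1 hk₀.1.1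
  obtain ⟨Φ, hΦ, hF⟩ := hnf
  obtain ⟨L, hL, hLF⟩ := exists_logMultipliers (F := fun z => Φ (G (Φ.symm z))) hlam0
    hres.generator_ne_zero hk₀ hF
  obtain ⟨r, hchart⟩ := exists_isNormalChart hG hΦ hLF
  simp only [mul_one_div] at hpos hneg
  refine ⟨fun h w => ?_, fun h =>
    hchart.exists_isParabolicManifold hres hΦ hL hk₀0 hmod rfl hnondeg hsn hpos h⟩
  obtain ⟨j, hj, hαj⟩ : ∃ j : Fin n, s ≤ (j : ℕ) ∧ α j ≠ 0 := by push Not at h; exact h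
  exact orbitConvergesToOrigin_iff hG hΦ hchart hL hk₀0 hmod (hres.monomialPow_generator hlam0)
    rfl hnondeg hαj (hneg j hj) w

theorem mainTheorem3 {n : ℕ} (G : OpenPartialHomeomorph (Fin n → ℂ) (Fin n → ℂ))
    (hG : IsBiholomorphicGerm G)
    (lam : Fin n → ℂ) (α : Fin n → ℕ) (hres : IsOneResonant G lam α)
    (hmod : ∀ j, ‖lam j‖ = 1) (hroot : ∀ j, ∀ q : ℕ, 1 ≤ q → lam j ^ q ≠ 1)
    (a : Fin n → ℕ → ℂ) (hnf : HasHolomorphicNormalForm G lam α a)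
    (k₀ : ℕ) (hk₀ : IsWeightedOrder a k₀)
    (hnondeg : resonantLambda lam α a k₀ ≠ 0)
    (s : ℕ) (hs1 : 1 ≤ s) (hsn : s < n)
    (hpos : ∀ j : Fin n, (j : ℕ) < s →
      0 < (a j k₀ / lam j * (1 / resonantLambda lam α a k₀)).re)
    (hneg : ∀ j : Fin n, s ≤ (j : ℕ) →
      (a j k₀ / lam j * (1 / resonantLambda lam α a k₀)).re < 0) :
    (¬ (∀ j : Fin n, s ≤ (j : ℕ) → α j = 0) →
      ∀ w : Fin n → ℂ, OrbitConvergesToOrigin G w ↔ w = 0) ∧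
    ((∀ j : Fin n, s ≤ (j : ℕ) → α j = 0) →
      ∃ P : Set (Fin n → ℂ), IsParabolicManifold G s (Finset.univ.gcd α) P) :=
  mainTheorem3_general G hG lam α hres hmod a hnf k₀ hk₀ hnondeg s hsn.le hpos hneg
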